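/- For coprime integers $p,q\ge 0$ let $T(p,q)\subset S^3\subset\mathbb{C}^2$ be the torus knot $\{\tfrac{1}{\sqrt2}(e^{2\pi i p t},e^{2\pi i q t}) : t\in\mathbb{R}\}$ on the standard torus $|z|=|w|$. For $n\ge 0$ let $K_n=T(4n,(2n+1)^2)$; the knot $K_0=T(0,1)$ is the unknot. A pinch move on a torus knot $T(p,q)$, with $p,q\ge 1$ coprime, is surgery on a straight band that lies on the standard torus and joins two adjacent strands of $T(p,q)$; knots are considered up to ambient isotopy in $S^3$. Explicitly, with coordinates $(x,y)\in\mathbb{R}^2/\mathbb{Z}^2$ on the torus, the band is an embedded parallelogram $\{(tp+u/q,\,tq) : c\le t\le c+d,\ 0\le u\le 1\}$ with $d>0$ that meets $T(p,q)$ exactly in its two sides $u=0$ and $u=1$ (or the analogous band with the two coordinates interchanged), and surgery removes the two open sides $u=0$ and $u=1$ from $T(p,q)$ and adds the sides $t=c$ and $t=c+d$. Let $n\ge 1$ and let $m\ge 0$ be an integer with $m\neq n$. Then $K_n$ cannot be obtained, up to ambient isotopy, from $K_m$ by a finite (possibly empty) sequence of pinch moves. -/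

import Mathlib

namespace Pinch

/-- The three-sphere, as the unit sphere of `ℂ²`. -/
abbrev S3 : Type := {v : ℂ × ℂ // ‖v.1‖ ^ 2 + ‖v.2‖ ^ 2 = 1}

/-- Two subsets of the three-sphere (for instance two unoriented knots) are isotopic if an ambient
isotopy of the three-sphere carries the first one onto the second one. -/
def Isotopic (K L : Set S3) : Prop :=
  ∃ H : unitInterval → (S3 ≃ₜ S3),
    Continuous (fun a : unitInterval × S3 => H a.1 a.2) ∧
    H 0 = Homeomorph.refl S3 ∧ H 1 '' K = L

theorem norm_exp_div_sqrt_two (x : ℝ) :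
    ‖Complex.exp (2 * Real.pi * x * Complex.I) / (Real.sqrt 2 : ℂ)‖ ^ 2 = 1 / 2 := by
  have h : (2 * Real.pi * x * Complex.I : ℂ) = ((2 * Real.pi * x : ℝ) : ℂ) * Complex.I := by
    push_cast; ring
  rw [norm_div, h, Complex.norm_exp_ofReal_mul_I, Complex.norm_real, div_pow, Real.norm_eq_abs,
    sq_abs, Real.sq_sqrt (by norm_num)]
  norm_num

/-- The covering map from the plane onto the standard torus `{|z| = |w|}` of the three-sphere,
with coordinates that have period one. -/
noncomputable def torusPoint (x y : ℝ) : S3 :=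
  ⟨(Complex.exp (2 * Real.pi * x * Complex.I) / (Real.sqrt 2 : ℂ),
    Complex.exp (2 * Real.pi * y * Complex.I) / (Real.sqrt 2 : ℂ)), by
    rw [norm_exp_div_sqrt_two, norm_exp_div_sqrt_two]; norm_num⟩

/-- The torus knot `T(p,q)` (for coprime `p` and `q`) in its standard position: the image on the
standard torus of the straight line through the origin with direction `(p,q)`. -/
noncomputable def torusKnot (p q : ℕ) : Set S3 :=
  Set.range fun t : ℝ => torusPoint (t * p) (t * q)

/-- `b`, restricted to the unit square, is a band attached to `K`: an embedded square that meets
`K` exactly in the two opposite sides `[0,1] × {0}` and `[0,1] × {1}`. -/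
structure IsBand (K : Set S3) (b : ℝ × ℝ → S3) : Prop where
  continuousOn : ContinuousOn b (Set.Icc 0 1 ×ˢ Set.Icc 0 1)
  injOn : Set.InjOn b (Set.Icc 0 1 ×ˢ Set.Icc 0 1)
  mem_iff : ∀ s ∈ Set.Icc (0 : ℝ) 1, ∀ x ∈ Set.Icc (0 : ℝ) 1, b (s, x) ∈ K ↔ x = 0 ∨ x = 1

/-- Surgery along a band: the two attaching arcs (without their endpoints) are removed from `K`,
and the two other sides of the band are added. -/
def surgery (K : Set S3) (b : ℝ × ℝ → S3) : Set S3 :=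
  (K \ b '' (Set.Ioo 0 1 ×ˢ {0, 1})) ∪ b '' ({0, 1} ×ˢ Set.Icc 0 1)

/-- The straight band on the standard torus that begins along the arc `c ≤ t ≤ c + d` of `T(p,q)`
and runs in the direction of the first coordinate over the length `1 / q`. The strands of `T(p,q)`
that cross a circle in this direction are exactly `1 / q` apart, so that the band runs from one
strand to the adjacent one. -/
noncomputable def straightBand (p q : ℕ) (c d : ℝ) (a : ℝ × ℝ) : S3 :=
  torusPoint ((c + d * a.1) * p + a.2 / q) ((c + d * a.1) * q)

/-- `L` is obtained from `K` by a pinch move: up to isotopy, `K` is a torus knot in its standard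
position, and `L` is the result of surgery along a band on the torus between adjacent strands.
Since `T(p,q)` and `T(q,p)` are isotopic by the interchange of the two coordinates, this also
covers the bands that run in the direction of the second coordinate. -/
def PinchMove (K L : Set S3) : Prop :=
  ∃ (p q : ℕ) (c d : ℝ), 0 < p ∧ 0 < q ∧ Nat.Coprime p q ∧ 0 < d ∧
    Isotopic K (torusKnot p q) ∧
    IsBand (torusKnot p q) (straightBand p q c d) ∧
    Isotopic (surgery (torusKnot p q) (straightBand p q c d)) L

/-- `L` is, up to isotopy, obtained from `K` by a finite sequence of pinch moves. -/
def ObtainedByPinchMoves (K L : Set S3) : Prop :=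
  ∃ K' : Set S3, Relation.ReflTransGen PinchMove K K' ∧ Isotopic K' L

/-- The torus knot `K_n = T(4n, (2n+1)²)`; `K_0 = T(0,1)` is unknotted. -/
noncomputable def knotK (n : ℕ) : Set S3 := torusKnot (4 * n) ((2 * n + 1) ^ 2)

end Pinch

/-!
The invariant is the fundamental group of the complement, and only the homeomorphism at the end of
an ambient isotopy matters. All knots in play are simple closed curves `K` on the standard torus
(`IsTorusCurve`), including those produced by surgery along a band.

The two coordinate axes are the cores of the two solid tori that the standard torus bounds. Both
solid tori, enlarged by the points off the cores whose projection to the torus is not on `K`, are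
open in the complement of `K`; they cover it, and their fundamental groups are infinite cyclic. For
a curve `K` in the class `(p, q)` this presents the fundamental group as `⟨a, b | a ^ q = b ^ p⟩`
(`TorusGluing.isTorusGroup`). In place of the theorem of van Kampen, generation is proved by
subdividing loops (`TorusGluing.closure_loops`), and homomorphisms out of the group are monodromy
representations of coverings built from the universal coverings of the two pieces
(`exists_monodromy`, `TorusGluing.exists_hom`).

The group recovers `{|p|, |q|}` if neither is `1` (`IsTorusGroup.natAbs_eq`): it acts on `ℂ` by
affine maps without a common fixed point and with linear parts of order `N > 1` exactly if
`N = d * e` with nontrivial divisors `d` of `q` and `e` of `p`. Indeed the generators then act by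
rotations with different centres, of orders `d` and `e`.

If `J * p = t * q + 1` with `0 ≤ J < q`, adjacent strands of `T(p,q)` differ by the time shift
`J / q`, and the embedded band is shorter than both arcs into which this shift divides the period.
The surgery along it is a curve in the class `(2t - p, 2J - q)`
(`IsPinchData.isTorusCurve_surgery`). Therefore every pinch move takes `T(2j, 2j(m+1)+1)`, up to
mirror images and the interchange of the coordinates, to `T(2(j-1), 2(j-1)(m+1)+1)`. It takes
`T(1,q)` to the class `(-1, 2 - q)`, again unknotted, and does not exist for `q = 1`
(`IsPinchClass.pinch`).
The knot `K_m` is `T(2j, 2j(m+1)+1)` for `j = 2m`, and for `n ≥ 1` no member of this family is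
`K_n` unless `m = n`.
-/

open Equiv

namespace Pinch

/-! ### Groups with two generators and the relation `a ^ q = b ^ p` -/

/-- `G` has generators `a`, `b` for which `a ^ q = b ^ p` is a defining relation. -/
def IsTorusGroup (G : Type) [Group G] (p q : ℤ) : Prop :=
  ∃ a b : G, Subgroup.closure {a, b} = ⊤ ∧ a ^ q = b ^ p ∧
    ∀ (H : Type) [Group H] (x y : H), x ^ q = y ^ p → ∃ ρ : G →* H, ρ a = x ∧ ρ b = y

/-- `G` acts on `ℂ` by affine maps without a common fixed point, and the linear parts form a
character of order `N`. -/
def HasAffineAction (G : Type) [Group G] (N : ℕ) : Prop :=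
  1 < N ∧ ∃ (ρ : G →* Perm ℂ) (χ : G →* ℂˣ), orderOf χ = N ∧
    (∀ g v, ρ g v = χ g * v + ρ g 0) ∧ ¬ ∃ v, ∀ g, ρ g v = v

theorem HasAffineAction.of_mulEquiv {G G' : Type} [Group G] [Group G'] {N : ℕ}
    (h : HasAffineAction G N) (f : G ≃* G') : HasAffineAction G' N := by
  obtain ⟨hN, ρ, χ, hord, haff, hfix⟩ := h
  refine ⟨hN, ρ.comp f.symm.toMonoidHom, χ.comp f.symm.toMonoidHom, ?_, fun g v => haff _ v, ?_⟩
  · rw [← hord, orderOf_eq_orderOf_iff]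
    intro n
    rw [MonoidHom.ext_iff, MonoidHom.ext_iff]
    refine ⟨fun h g => ?_, fun h g => ?_⟩
    · simpa using h (f g)
    · simpa using h (f.symm g)
  · rintro ⟨v, hv⟩
    exact hfix ⟨v, fun g => by simpa using hv (f g)⟩

theorem fixed_of_closure {G : Type} [Group G] {a b : G} (hgen : Subgroup.closure {a, b} = ⊤)
    (ρ : G →* Perm ℂ) {v : ℂ} (ha : ρ a v = v) (hb : ρ b v = v) (g : G) : ρ g v = v := by
  have : Subgroup.closure {a, b} ≤ (MulAction.stabilizer (Perm ℂ) v).comap ρ := by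
    rw [Subgroup.closure_le]
    rintro _ (rfl | rfl)
    · exact ha
    · exact hb
  exact this (hgen ▸ Subgroup.mem_top g)

/-- If the linear part of `ρ a` is nontrivial, its fixed point is also fixed by `ρ (b ^ p)`. As it
is not fixed by `ρ b`, the map `ρ b` is a rotation of finite order dividing `p`. -/
theorem linearPart_zpow_eq_one {G : Type} [Group G] {a b : G} {p q : ℤ} (hpq : IsCoprime p q)
    (hgen : Subgroup.closure {a, b} = ⊤) (hrel : a ^ q = b ^ p) {ρ : G →* Perm ℂ} {χ : G →* ℂˣ}
    (haff : ∀ g v, ρ g v = χ g * v + ρ g 0) (hfix : ¬ ∃ v, ∀ g, ρ g v = v) (ha : χ a ≠ 1) :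
    χ b ≠ 1 ∧ χ b ^ p = 1 := by
  have fixpt : ∀ g, χ g ≠ 1 → ρ g (ρ g 0 / (1 - χ g)) = ρ g 0 / (1 - χ g) := by
    intro g hg
    have : (1 - χ g : ℂ) ≠ 0 := by
      rw [sub_ne_zero]
      exact fun h => hg (Units.ext h.symm)
    rw [haff g (ρ g 0 / (1 - χ g))]
    field_simp
    ring
  have uniq : ∀ g v w, χ g ≠ 1 → ρ g v = v → ρ g w = w → v = w := by
    intro g v w hg hv hw
    rw [haff] at hv hw
    by_contra hne
    apply hg
    apply Units.ext
    have : ((χ g : ℂ) - 1) * (v - w) = 0 := by linear_combination hv - hw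
    rcases mul_eq_zero.1 this with h | h
    · simpa using sub_eq_zero.1 h
    · exact absurd (sub_eq_zero.1 h) hne
  have pow_fix : ∀ (g : G) v (n : ℤ), ρ g v = v → ρ (g ^ n) v = v := by
    intro g v n h
    rw [map_zpow]
    exact (MulAction.stabilizer (Perm ℂ) v).zpow_mem (x := ρ g) h n
  set v := ρ a 0 / (1 - χ a) with hv
  have hav := fixpt a ha
  rw [← hv] at hav
  have hbv : ρ (b ^ p) v = v := by rw [← hrel]; exact pow_fix a v q hav
  have hnb : ρ b v ≠ v := fun h => hfix ⟨v, fixed_of_closure hgen ρ hav h⟩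
  have hb : χ b ≠ 1 := by
    intro hb
    have htr : ∀ n : ℤ, ∀ w, ρ (b ^ n) w = w + n * ρ b 0 := by
      have hone : ∀ w, ρ b w = w + ρ b 0 := fun w => by rw [haff, hb]; simp
      intro n
      induction n with
      | zero => simp
      | succ n ih =>
        intro w
        rw [zpow_add_one, map_mul, Perm.mul_apply, hone, ih]; push_cast; ring
      | pred n ih =>
        intro w
        have : ρ (b ^ (-(n : ℤ) - 1)) (ρ b (w - ρ b 0)) = w - ρ b 0 + (-(n : ℤ) : ℤ) * ρ b 0 := by
          rw [← ih, ← Perm.mul_apply, ← map_mul, ← zpow_add_one]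
          congr 3
          ring
        rw [hone, sub_add_cancel] at this
        rw [this]; push_cast; ring
    have h0 := htr p v
    rw [hbv] at h0
    have : (p : ℂ) * ρ b 0 = 0 := by linear_combination -h0
    rcases mul_eq_zero.1 this with h | h
    · have hp : p = 0 := by exact_mod_cast h
      subst hp
      have hq : IsUnit q := isCoprime_zero_left.1 hpq
      rw [zpow_zero] at hrel
      apply ha
      have : a = 1 := by
        rcases Int.isUnit_iff.1 hq with rfl | rfl <;> simpa using hrel
      rw [this, map_one]
    · exact hnb (by have := htr 1 v; rw [zpow_one, h] at this; simpa using this)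
  refine ⟨hb, ?_⟩
  by_contra hbp
  rw [← map_zpow] at hbp
  refine hnb ?_
  have := uniq (b ^ p) v _ hbp hbv (pow_fix b _ p (fixpt b hb))
  rw [this]
  exact fixpt b hb

/-- Both generators of a torus group have nontrivial linear parts, and their orders divide `q` and
`p`. -/
theorem HasAffineAction.exists_dvd {G : Type} [Group G] {p q : ℤ} {N : ℕ} (hpq : IsCoprime p q)
    (h : IsTorusGroup G p q) (hN : HasAffineAction G N) :
    ∃ d e : ℕ, d ∣ q.natAbs ∧ e ∣ p.natAbs ∧ 1 < d ∧ 1 < e ∧ N = d * e := by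
  obtain ⟨a, b, hgen, hrel, -⟩ := h
  obtain ⟨hN, ρ, χ, hord, haff, hfix⟩ := hN
  have key1 := linearPart_zpow_eq_one hpq hgen hrel haff hfix
  have key2 := linearPart_zpow_eq_one hpq.symm (by rw [Set.pair_comm]; exact hgen) hrel.symm
    haff hfix
  have hχ : ∀ n : ℕ, χ ^ n = 1 ↔ χ a ^ n = 1 ∧ χ b ^ n = 1 := by
    intro n
    refine ⟨fun h => ⟨DFunLike.congr_fun h a, DFunLike.congr_fun h b⟩, fun h => ?_⟩
    refine MonoidHom.eq_of_eqOn_dense hgen ?_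
    rintro _ (rfl | rfl)
    · exact h.1
    · exact h.2
  have hab : χ a ≠ 1 ∨ χ b ≠ 1 := by
    by_contra hcon
    push Not at hcon
    have : χ ^ 1 = 1 := (hχ 1).2 (by simpa using hcon)
    rw [pow_one] at this
    rw [this, orderOf_one] at hord
    omega
  obtain ⟨ha1, haq, hb1, hbp⟩ : χ a ≠ 1 ∧ χ a ^ q = 1 ∧ χ b ≠ 1 ∧ χ b ^ p = 1 := by
    rcases hab with h | h
    · have h1 := key1 h
      have h2 := key2 h1.1
      exact ⟨h, h2.2, h1⟩
    · have h1 := key2 h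
      have h2 := key1 h1.1
      exact ⟨h1.1, h1.2, h, h2.2⟩
  have hd : orderOf (χ a) ∣ q.natAbs := by
    rw [← Int.natCast_dvd]; exact orderOf_dvd_iff_zpow_eq_one.2 haq
  have he : orderOf (χ b) ∣ p.natAbs := by
    rw [← Int.natCast_dvd]; exact orderOf_dvd_iff_zpow_eq_one.2 hbp
  have hco : Nat.Coprime (orderOf (χ a)) (orderOf (χ b)) :=
    Nat.Coprime.of_dvd hd he (Int.isCoprime_iff_gcd_eq_one.1 hpq.symm)
  have hNeq : N = orderOf (χ a) * orderOf (χ b) := by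
    rw [← hord]
    apply Nat.dvd_antisymm
    · rw [orderOf_dvd_iff_pow_eq_one, hχ, ← orderOf_dvd_iff_pow_eq_one,
        ← orderOf_dvd_iff_pow_eq_one]
      exact ⟨dvd_mul_right _ _, dvd_mul_left _ _⟩
    · have := (hχ _).1 (pow_orderOf_eq_one χ)
      exact hco.mul_dvd_of_dvd_of_dvd (orderOf_dvd_of_pow_eq_one this.1)
        (orderOf_dvd_of_pow_eq_one this.2)
  have h0 : orderOf (χ a) * orderOf (χ b) ≠ 0 := by omega
  have h1 : orderOf (χ a) ≠ 1 := fun h => ha1 (orderOf_eq_one_iff.1 h)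
  have h2 : orderOf (χ b) ≠ 1 := fun h => hb1 (orderOf_eq_one_iff.1 h)
  have h3 := left_ne_zero_of_mul h0
  have h4 := right_ne_zero_of_mul h0
  exact ⟨_, _, hd, he, by omega, by omega, hNeq⟩

/-- The generators can be sent to rotations of orders `d` and `e` with different centres. -/
theorem IsTorusGroup.hasAffineAction {G : Type} [Group G] {p q : ℤ} (h : IsTorusGroup G p q)
    (hpq : IsCoprime p q) {d e : ℕ} (hd : d ∣ q.natAbs) (he : e ∣ p.natAbs) (hd1 : 1 < d)
    (he1 : 1 < e) : HasAffineAction G (d * e) := by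
  obtain ⟨a, b, hgen, hrel, hex⟩ := h
  have root : ∀ n : ℕ, 1 < n → ∃ ζ : ℂˣ, orderOf ζ = n := by
    intro n hn
    have hz := Complex.isPrimitiveRoot_exp n (by omega)
    obtain ⟨ζ, hζ⟩ := hz.isUnit (by omega)
    refine ⟨ζ, ?_⟩
    rw [← orderOf_units, hζ]
    exact hz.eq_orderOf.symm
  obtain ⟨α, hα⟩ := root d hd1
  obtain ⟨β, hβ⟩ := root e he1
  have hαq : α ^ q = 1 := by
    rw [← orderOf_dvd_iff_zpow_eq_one, hα, Int.natCast_dvd]; exact hd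
  have hβp : β ^ p = 1 := by
    rw [← orderOf_dvd_iff_zpow_eq_one, hβ, Int.natCast_dvd]; exact he
  obtain ⟨χ, hχa, hχb⟩ := hex ℂˣ α β (by rw [hαq, hβp])
  let S := MulAction.toPermHom ℂˣ ℂ
  -- The rotation about `0` by `α` and the rotation about `1` by `β`.
  let t : Perm ℂ := Equiv.addRight 1
  obtain ⟨ρ, hρa, hρb⟩ := hex (Perm ℂ) (S α) (t * S β * t⁻¹) (by
    rw [conj_zpow, ← map_zpow, ← map_zpow, hαq, hβp]; simp)
  have hA : ∀ v, ρ a v = α * v := fun v => by rw [hρa]; rfl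
  have hB : ∀ v, ρ b v = β * (v - 1) + 1 := fun v => by rw [hρb]; rfl
  refine ⟨by nlinarith, ρ, χ, ?_, ?_, ?_⟩
  · have hχ : ∀ n : ℕ, χ ^ n = 1 ↔ α ^ n = 1 ∧ β ^ n = 1 := by
      intro n
      refine ⟨fun h => ⟨hχa ▸ DFunLike.congr_fun h a, hχb ▸ DFunLike.congr_fun h b⟩, fun h => ?_⟩
      refine MonoidHom.eq_of_eqOn_dense hgen ?_
      rintro _ (rfl | rfl)
      · simpa [hχa] using h.1
      · simpa [hχb] using h.2
    have hco : Nat.Coprime d e := Nat.Coprime.of_dvd hd he (Int.isCoprime_iff_gcd_eq_one.1 hpq.symm)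
    apply Nat.dvd_antisymm
    · rw [orderOf_dvd_iff_pow_eq_one, hχ, ← orderOf_dvd_iff_pow_eq_one,
        ← orderOf_dvd_iff_pow_eq_one, hα, hβ]
      exact ⟨dvd_mul_right _ _, dvd_mul_left _ _⟩
    · have := (hχ _).1 (pow_orderOf_eq_one χ)
      rw [← orderOf_dvd_iff_pow_eq_one, ← orderOf_dvd_iff_pow_eq_one, hα, hβ] at this
      exact hco.mul_dvd_of_dvd_of_dvd this.1 this.2
  · intro g
    have hg : g ∈ Subgroup.closure {a, b} := hgen ▸ Subgroup.mem_top g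
    induction hg using Subgroup.closure_induction with
    | mem x hx =>
      intro v
      rcases hx with rfl | rfl
      · rw [hA, hA, hχa]; ring
      · rw [hB, hB, hχb]; ring
    | one => simp
    | mul x y _ _ hx hy =>
      intro v
      rw [map_mul, Perm.mul_apply, Perm.mul_apply, hx, hy, hx (ρ y 0), map_mul, Units.val_mul]
      ring
    | inv x _ hx =>
      intro v
      rw [map_inv, map_inv]
      have hinv : ∀ w, ρ x ((ρ x)⁻¹ w) = w := (ρ x).apply_symm_apply
      apply (ρ x).injective
      rw [hinv, hx]
      have h0 := hx ((ρ x)⁻¹ 0)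
      rw [hinv] at h0
      have : (χ x : ℂ) * ((χ x)⁻¹ : ℂˣ) = 1 := by simp
      linear_combination (-v) * this + h0
  · rintro ⟨v, hv⟩
    have h1 := hv a
    have h2 := hv b
    rw [hA] at h1
    rw [hB] at h2
    have hα1 : (α : ℂ) - 1 ≠ 0 := by
      intro h
      have : α = 1 := Units.ext (by simpa using sub_eq_zero.1 h)
      rw [this, orderOf_one] at hα; omega
    have hβ1 : (β : ℂ) - 1 ≠ 0 := by
      intro h
      have : β = 1 := Units.ext (by simpa using sub_eq_zero.1 h)
      rw [this, orderOf_one] at hβ; omega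
    have e1 : v = 0 :=
      (mul_eq_zero.1 (by linear_combination h1 : ((α : ℂ) - 1) * v = 0)).resolve_left hα1
    have e2 : v - 1 = 0 :=
      (mul_eq_zero.1 (by linear_combination h2 : ((β : ℂ) - 1) * (v - 1) = 0)).resolve_left hβ1
    rw [e1] at e2
    norm_num at e2

/-- A coprime factorization `p * q` is recovered from the products of nontrivial divisors of the
two factors: no divisor of `p` is such a product. -/
theorem eq_or_swap_of_products {p q p' q' : ℕ} (hpq : p.Coprime q) (hpq' : p'.Coprime q')
    (hp : 2 ≤ p) (hq : 2 ≤ q)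
    (h : ∀ N, (∃ d e, d ∣ q ∧ e ∣ p ∧ 1 < d ∧ 1 < e ∧ N = d * e) ↔
      ∃ d e, d ∣ q' ∧ e ∣ p' ∧ 1 < d ∧ 1 < e ∧ N = d * e) :
    (p = p' ∧ q = q') ∨ (p = q' ∧ q = p') := by
  obtain ⟨d, e, hd, he, hd1, he1, hde⟩ := (h (q * p)).1 ⟨q, p, dvd_rfl, dvd_rfl, hq, hp, rfl⟩
  have hp' : 2 ≤ p' := by
    rcases Nat.lt_or_ge p' 2 with h2 | h2
    · interval_cases p'
      · rw [Nat.coprime_zero_left] at hpq'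
        subst hpq'
        have := Nat.dvd_one.1 hd; omega
      · have := Nat.dvd_one.1 he; omega
    · exact h2
  have hq' : 2 ≤ q' := by
    rcases Nat.lt_or_ge q' 2 with h2 | h2
    · interval_cases q'
      · rw [Nat.coprime_zero_right] at hpq'
        omega
      · have := Nat.dvd_one.1 hd; omega
    · exact h2
  have hdvd : q * p ∣ q' * p' := hde ▸ mul_dvd_mul hd he
  have hdvd' : q' * p' ∣ q * p := by
    obtain ⟨d, e, hd, he, -, -, hde⟩ := (h (q' * p')).2 ⟨q', p', dvd_rfl, dvd_rfl, hq', hp', rfl⟩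
    exact hde ▸ mul_dvd_mul hd he
  have heq : q * p = q' * p' := Nat.dvd_antisymm hdvd hdvd'
  -- A number `r` dividing a factor of one pair divides a factor of the other one.
  have main : ∀ {a b a' b' r : ℕ}, a.Coprime b → a'.Coprime b' → 0 < r → (r ∣ a ∨ r ∣ b) →
      r ∣ a' * b' →
      ((∃ d e, d ∣ b' ∧ e ∣ a' ∧ 1 < d ∧ 1 < e ∧ r = d * e) →
        ∃ d e, d ∣ b ∧ e ∣ a ∧ 1 < d ∧ 1 < e ∧ r = d * e) → (r ∣ a' ∨ r ∣ b') := by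
    intro a b a' b' r hab hab' hr0 hr hr' hS
    have hg : r = r.gcd b' * r.gcd a' := by
      rw [mul_comm, ← hab'.gcd_mul, Nat.gcd_eq_left hr']
    by_cases h1 : r.gcd b' = 1
    · left; rw [h1, one_mul] at hg; rw [hg]; exact Nat.gcd_dvd_right _ _
    by_cases h2 : r.gcd a' = 1
    · right; rw [h2, mul_one] at hg; rw [hg]; exact Nat.gcd_dvd_right _ _
    have h3 : 0 < r.gcd b' := Nat.gcd_pos_of_pos_left _ hr0
    have h4 : 0 < r.gcd a' := Nat.gcd_pos_of_pos_left _ hr0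
    obtain ⟨d, e, hd, he, hd1, he1, hde⟩ := hS ⟨_, _, Nat.gcd_dvd_right _ _, Nat.gcd_dvd_right _ _,
      by omega, by omega, hg⟩
    exfalso
    rcases hr with hr | hr
    · have := Nat.eq_one_of_dvd_coprimes hab ((Dvd.intro _ hde.symm).trans hr) hd
      omega
    · have := Nat.eq_one_of_dvd_coprimes hab he ((Dvd.intro_left _ hde.symm).trans hr)
      omega
  have m1 := main hpq hpq' (by omega : 0 < p) (Or.inl dvd_rfl)
    (by rw [mul_comm, ← heq]; exact dvd_mul_left _ _) (h p).2
  have m2 := main hpq' hpq (by omega : 0 < p') (Or.inl dvd_rfl)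
    (by rw [mul_comm, heq]; exact dvd_mul_left _ _) (h p').1
  have m3 := main hpq' hpq (by omega : 0 < q') (Or.inr dvd_rfl)
    (by rw [mul_comm, heq]; exact dvd_mul_right _ _) (h q').1
  have np : ∀ {a : ℕ}, 2 ≤ a → a ∣ p → ¬ a ∣ q := fun ha h1 h2 => by
    have := Nat.eq_one_of_dvd_coprimes hpq h1 h2; omega
  have np' : ∀ {a : ℕ}, 2 ≤ a → a ∣ p' → ¬ a ∣ q' := fun ha h1 h2 => by
    have := Nat.eq_one_of_dvd_coprimes hpq' h1 h2; omega
  rcases m1 with m1 | m1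
  · rcases m2 with m2 | m2
    · have : p = p' := Nat.dvd_antisymm m1 m2
      subst this
      exact Or.inl ⟨rfl, Nat.eq_of_mul_eq_mul_right (by omega) heq⟩
    · exact absurd (m1.trans m2) (np hp dvd_rfl)
  · rcases m3 with m3 | m3
    · have : p = q' := Nat.dvd_antisymm m1 m3
      subst this
      exact Or.inr ⟨rfl, Nat.eq_of_mul_eq_mul_right (by omega : 0 < p) (by rw [heq, mul_comm])⟩
    · exact absurd (m1.trans m3) (np hp dvd_rfl)

/-- The exponents of a torus group are determined by the group, unless one of them is `±1`. -/
theorem IsTorusGroup.natAbs_eq {G G' : Type} [Group G] [Group G'] {p q p' q' : ℤ}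
    (h : IsTorusGroup G p q) (h' : IsTorusGroup G' p' q') (f : G ≃* G') (hpq : IsCoprime p q)
    (hpq' : IsCoprime p' q') :
    ((p'.natAbs = 1 ∨ q'.natAbs = 1) ∧ (p.natAbs = 1 ∨ q.natAbs = 1)) ∨
      (p.natAbs = p'.natAbs ∧ q.natAbs = q'.natAbs) ∨
      (p.natAbs = q'.natAbs ∧ q.natAbs = p'.natAbs) := by
  have hS : ∀ N, (∃ d e, d ∣ q.natAbs ∧ e ∣ p.natAbs ∧ 1 < d ∧ 1 < e ∧ N = d * e) ↔
      ∃ d e, d ∣ q'.natAbs ∧ e ∣ p'.natAbs ∧ 1 < d ∧ 1 < e ∧ N = d * e := by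
    intro N
    constructor
    · rintro ⟨d, e, hd, he, hd1, he1, rfl⟩
      exact ((h.hasAffineAction hpq hd he hd1 he1).of_mulEquiv f).exists_dvd hpq' h'
    · rintro ⟨d, e, hd, he, hd1, he1, rfl⟩
      exact ((h'.hasAffineAction hpq' hd he hd1 he1).of_mulEquiv f.symm).exists_dvd hpq h
  have hc : p.natAbs.Coprime q.natAbs := Int.isCoprime_iff_gcd_eq_one.1 hpq
  have hc' : p'.natAbs.Coprime q'.natAbs := Int.isCoprime_iff_gcd_eq_one.1 hpq'
  have big : ∀ {a b : ℕ}, a.Coprime b → ¬ (a = 1 ∨ b = 1) → 2 ≤ a ∧ 2 ≤ b := by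
    intro a b hab hn
    push Not at hn
    have ha : a ≠ 0 := by rintro rfl; exact hn.2 ((Nat.coprime_zero_left _).1 hab)
    have hb : b ≠ 0 := by rintro rfl; exact hn.1 ((Nat.coprime_zero_right _).1 hab)
    omega
  by_cases h1 : p.natAbs = 1 ∨ q.natAbs = 1
  · by_cases h2 : p'.natAbs = 1 ∨ q'.natAbs = 1
    · exact Or.inl ⟨h2, h1⟩
    · have := eq_or_swap_of_products hc' hc (big hc' h2).1 (big hc' h2).2 fun N => (hS N).symm
      right; tauto
  · right
    exact eq_or_swap_of_products hc hc' (big hc h1).1 (big hc h1).2 hS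

/-! ### Monodromy, and the fundamental group of a union of two cyclic pieces -/

open Set Filter Topology

/-- A family `ψ` of permutations, indexed by a space `Y` over `X` that has local sections, gives a
covering space of `X` if the change of frame `(ψ b)⁻¹ * ψ a` is locally constant on the fibre
product. This is its monodromy, computed along the loops of `X` that lift to `Y`. -/
theorem exists_monodromy {X Y F : Type} [TopologicalSpace X] [TopologicalSpace Y] (π : C(Y, X))
    (hsec : ∀ x, ∃ (O : Set X) (σ : X → Y), IsOpen O ∧ x ∈ O ∧ ContinuousOn σ O ∧
      ∀ x' ∈ O, π (σ x') = x')
    (ψ : Y → Perm F)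
    (hψ : ∀ y y', π y = π y' → ∀ᶠ w in 𝓝 (y, y'), π w.1 = π w.2 →
      (ψ w.2)⁻¹ * ψ w.1 = (ψ y')⁻¹ * ψ y) (x₀ : X) :
    ∃ ρ : FundamentalGroup X x₀ →* Perm F, ∀ (γ : Path x₀ x₀) (y₀ y₁ : Y) (Γ : Path y₀ y₁),
      (∀ t, π (Γ t) = γ t) →
        ρ (FundamentalGroup.fromPath (Path.Homotopic.Quotient.mk γ)) = ψ y₁ * (ψ y₀)⁻¹ := by
  let ι : Type := {s : Set X × (X → Y) // IsOpen s.1 ∧ ContinuousOn s.2 s.1 ∧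
    ∀ x ∈ s.1, π (s.2 x) = x}
  have hidx : ∀ x, ∃ i : ι, x ∈ i.1.1 := by
    intro x
    obtain ⟨O, σ, h1, h2, h3, h4⟩ := hsec x
    exact ⟨⟨(O, σ), h1, h3, h4⟩, h2⟩
  choose idx hidx using hidx
  let _ : TopologicalSpace F := ⊥
  have : DiscreteTopology F := ⟨rfl⟩
  let Z : FiberBundleCore ι X F :=
    { baseSet := fun i => i.1.1
      isOpen_baseSet := fun i => i.2.1
      indexAt := idx
      mem_baseSet_at := hidx
      coordChange := fun i j x v => ((ψ (j.1.2 x))⁻¹ * ψ (i.1.2 x)) v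
      coordChange_self := fun i x _ v => by simp
      continuousOn_coordChange := by
        rintro i j ⟨x, v⟩ ⟨hx, -⟩
        refine ContinuousAt.continuousWithinAt ?_
        have hi : ContinuousAt i.1.2 x := i.2.2.1.continuousAt (i.2.1.mem_nhds hx.1)
        have hj : ContinuousAt j.1.2 x := j.2.2.1.continuousAt (j.2.1.mem_nhds hx.2)
        have hev := (hi.prodMk hj).eventually
          (hψ (i.1.2 x) (j.1.2 x) ((i.2.2.2 x hx.1).trans (j.2.2.2 x hx.2).symm))
        have hfst : Tendsto Prod.fst (𝓝 (x, v)) (𝓝 x) := continuous_fst.continuousAt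
        have hsnd : ∀ᶠ w : X × F in 𝓝 (x, v), w.2 = v :=
          (continuous_snd.tendsto (x, v)).eventually (p := fun w => w = v)
            (by simp [nhds_discrete])
        refine ContinuousAt.congr (f := fun _ => ((ψ (j.1.2 x))⁻¹ * ψ (i.1.2 x)) v)
          continuousAt_const ?_
        filter_upwards [hfst.eventually hev, hsnd, hfst.eventually (i.2.1.mem_nhds hx.1),
          hfst.eventually (j.2.1.mem_nhds hx.2)] with w h1 h2 h3 h4
        have := h1 ((i.2.2.2 _ h3).trans (j.2.2.2 _ h4).symm)
        rw [h2]
        exact (congrArg (fun g : Perm F => g v) this).symm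
      coordChange_comp := fun i j k x _ v => by simp }
  have hcov : IsCoveringMap (Bundle.TotalSpace.proj : Bundle.TotalSpace F Z.Fiber → X) :=
    FiberBundle.isCoveringMap
  let fr : X → Perm F := fun x => ψ ((idx x).1.2 x)
  -- The section over `Y` whose value in the frame `ψ` is constant.
  let s : F → Y → Bundle.TotalSpace F Z.Fiber := fun v y => ⟨π y, ((fr (π y))⁻¹ * ψ y) v⟩
  have hs : ∀ v, Continuous (s v) := by
    intro v
    rw [continuous_iff_continuousAt]
    intro y
    rw [FiberBundle.continuousAt_totalSpace F]
    refine ⟨π.continuous.continuousAt, ?_⟩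
    set i := idx (π y) with hi
    have hx : π y ∈ i.1.1 := hidx _
    have hσ : ContinuousAt (fun y' => i.1.2 (π y')) y :=
      (i.2.2.1.continuousAt (i.2.1.mem_nhds hx)).comp π.continuous.continuousAt
    have hev := (continuousAt_id.prodMk hσ).eventually (hψ y (i.1.2 (π y)) (i.2.2.2 _ hx).symm)
    refine ContinuousAt.congr (f := fun _ => ((ψ (i.1.2 (π y)))⁻¹ * ψ y) v) continuousAt_const ?_
    filter_upwards [hev, π.continuous.continuousAt.eventually (i.2.1.mem_nhds hx)] with y' h1 h2
    have := h1 (i.2.2.2 _ h2).symm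
    simp only [id] at this
    change _ = ((ψ (i.1.2 (π y')))⁻¹ * ψ ((idx (π y')).1.2 (π y'))) (((fr (π y'))⁻¹ * ψ y') v)
    rw [← this]
    simp [fr]
  let Θ : F ≃ (Bundle.TotalSpace.proj : Bundle.TotalSpace F Z.Fiber → X) ⁻¹' {x₀} :=
    { toFun := fun r => ⟨⟨x₀, (fr x₀)⁻¹ r⟩, rfl⟩
      invFun := fun e => fr e.1.1 e.1.2
      left_inv := fun r => (fr x₀).apply_symm_apply r
      right_inv := by
        rintro ⟨⟨x, v⟩, hx⟩
        obtain rfl : x = x₀ := hx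
        exact Subtype.ext (congrArg (fun w : F => (⟨x, w⟩ : Bundle.TotalSpace F Z.Fiber))
          ((fr x).symm_apply_apply v)) }
  refine ⟨(Θ.permCongrHom.symm.toMonoidHom).comp (hcov.monodromyPerm x₀), ?_⟩
  intro γ y₀ y₁ Γ hΓ
  ext r
  have hy₀ : π y₀ = x₀ := by rw [← Γ.source, hΓ, γ.source]
  have hy₁ : π y₁ = x₀ := by rw [← Γ.target, hΓ, γ.target]
  have hΘ : ∀ y (hy : π y = x₀) v, Θ (ψ y v) = ⟨s v y, hy⟩ := by
    intro y hy v
    subst hy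
    rfl
  have hmono : hcov.monodromyPerm x₀
      (FundamentalGroup.fromPath (Path.Homotopic.Quotient.mk γ)) (Θ r) =
      Θ ((ψ y₁ * (ψ y₀)⁻¹) r) := by
    obtain ⟨v, rfl⟩ := (ψ y₀).surjective r
    have : (ψ y₁ * (ψ y₀)⁻¹) (ψ y₀ v) = ψ y₁ v := by simp
    rw [this, hΘ y₀ hy₀, hΘ y₁ hy₁]
    change hcov.monodromy (Path.Homotopic.Quotient.mk γ) _ = _
    refine hcov.monodromy_eq_of_map_eq (γ := Path.Homotopic.Quotient.mk γ)
      (ex := ⟨s v y₀, hy₀⟩) (ey := ⟨s v y₁, hy₁⟩)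
      (Path.Homotopic.Quotient.mk (Γ.map (hs v))) ?_
    rw [← Path.Homotopic.Quotient.mk_map]
    change _ = Path.Homotopic.Quotient.mk (γ.cast hy₀ hy₁)
    congr 1
    ext t
    exact hΓ t
  change Θ.symm (hcov.monodromyPerm x₀ _ (Θ r)) = _
  rw [hmono, Θ.symm_apply_apply]

/-- An open subset of `X`, the image of `f`, together with its universal covering `E`, on which the
integers act as deck transformations. -/
structure CyclicPiece (X : Type) [TopologicalSpace X] where
  /-- the covering space -/
  E : Type
  [top : TopologicalSpace E]
  [simplyConnected : SimplyConnectedSpace E]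
  /-- the covering map onto its image -/
  f : C(E, X)
  /-- the action of the integers -/
  shift : ℤ → C(E, E)
  shift_zero : ∀ e, shift 0 e = e
  shift_add : ∀ m n e, shift (m + n) e = shift m (shift n e)
  shift_free : ∀ n e, shift n e = e → n = 0
  f_shift : ∀ n e, f (shift n e) = f e
  exists_shift : ∀ e e', f e = f e' → ∃ n, e' = shift n e
  /-- paths in the image of `f` lift -/
  lift : ∀ {x y : X} (γ : Path x y), (∀ t, γ t ∈ range f) → ∀ e, f e = x →
    ∃ (e' : E) (Γ : Path e e'), ∀ t, f (Γ t) = γ t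
  locInj : ∀ e, ∃ N ∈ 𝓝 e, InjOn f N
  localSection : ∀ e, ∃ (O : Set X) (σ : X → E), IsOpen O ∧ f e ∈ O ∧ ContinuousOn σ O ∧
    ∀ x ∈ O, f (σ x) = x

attribute [instance] CyclicPiece.top CyclicPiece.simplyConnected

namespace CyclicPiece

variable {X : Type} [TopologicalSpace X] (P : CyclicPiece X)

theorem isOpen_range : IsOpen (range P.f) := by
  rw [isOpen_iff_mem_nhds]
  rintro _ ⟨e, rfl⟩
  obtain ⟨O, σ, hO, he, -, hσ⟩ := P.localSection e
  exact mem_of_superset (hO.mem_nhds he) fun x hx => ⟨σ x, hσ x hx⟩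

theorem shift_inj {m n : ℤ} {e : P.E} (h : P.shift m e = P.shift n e) : m = n := by
  have := P.shift_free (-n + m) e (by
    rw [P.shift_add, h, ← P.shift_add, neg_add_cancel, P.shift_zero])
  omega

/-- The homotopy class of the images of the paths from `e` to `e'`. -/
noncomputable def cls {x y : X} (e e' : P.E) (he : P.f e = x) (he' : P.f e' = y) :
    Path.Homotopic.Quotient x y :=
  .mk (((PathConnectedSpace.somePath e e').map P.f.continuous).cast he.symm he'.symm)

theorem mk_eq_cls {x y : X} {e e' : P.E} (he : P.f e = x) (he' : P.f e' = y) (γ : Path x y)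
    (Γ : Path e e') (h : ∀ t, P.f (Γ t) = γ t) : .mk γ = P.cls e e' he he' := by
  subst he he'
  have : γ = Γ.map P.f.continuous := by
    ext t
    exact (h t).symm
  rw [this, cls, Path.Homotopic.Quotient.eq]
  exact (SimplyConnectedSpace.paths_homotopic Γ _).map P.f

theorem cls_congr {x y : X} {e₁ e₁' e₂ e₂' : P.E} (h : e₁ = e₂) (h' : e₁' = e₂')
    (he : P.f e₁ = x) (he' : P.f e₁' = y) :
    P.cls e₁ e₁' he he' = P.cls e₂ e₂' (h ▸ he) (h' ▸ he') := by
  subst h h'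
  rfl

theorem cls_trans {x y z : X} {e e' e'' : P.E} (he : P.f e = x) (he' : P.f e' = y)
    (he'' : P.f e'' = z) :
    (P.cls e e' he he').trans (P.cls e' e'' he' he'') = P.cls e e'' he he'' := by
  subst he he' he''
  rw [cls, cls, ← Path.Homotopic.Quotient.mk_trans]
  refine P.mk_eq_cls rfl rfl _ ((PathConnectedSpace.somePath e e').trans
    (PathConnectedSpace.somePath e' e'')) fun t => ?_
  have := congrArg (fun p : Path (P.f e) (P.f e'') => p t)
    (Path.map_trans (PathConnectedSpace.somePath e e') (PathConnectedSpace.somePath e' e'')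
      P.f.continuous)
  exact this

theorem cls_shift {x y : X} {e e' : P.E} (he : P.f e = x) (he' : P.f e' = y) (n : ℤ) :
    P.cls (P.shift n e) (P.shift n e') ((P.f_shift n e).trans he) ((P.f_shift n e').trans he') =
      P.cls e e' he he' := by
  subst he he'
  symm
  exact P.mk_eq_cls _ _ _ ((PathConnectedSpace.somePath e e').map (P.shift n).continuous)
    fun t => P.f_shift n _

/-- The class of the loop that lifts to a path from `e` to `shift n e`. -/
noncomputable def loop {x : X} (e : P.E) (he : P.f e = x) (n : ℤ) : FundamentalGroup X x :=
  FundamentalGroup.fromPath (P.cls e (P.shift n e) he ((P.f_shift n e).trans he))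

theorem loop_add {x : X} (e : P.E) (he : P.f e = x) (m n : ℤ) :
    P.loop e he (m + n) = P.loop e he m * P.loop e he n := by
  have h1 := P.cls_shift he ((P.f_shift m e).trans he) n
  have h2 := P.cls_trans he ((P.f_shift n e).trans he)
    ((P.f_shift n _).trans ((P.f_shift m e).trans he))
  rw [h1] at h2
  rw [FundamentalGroup.mul_def]
  refine Eq.trans ?_ h2.symm
  unfold loop
  have : P.shift (m + n) e = P.shift n (P.shift m e) := by rw [add_comm, P.shift_add]
  exact P.cls_congr rfl this _ _

theorem loop_eq_zpow {x : X} (e : P.E) (he : P.f e = x) (n : ℤ) :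
    P.loop e he n = P.loop e he 1 ^ n := by
  let φ : Multiplicative ℤ →* FundamentalGroup X x :=
    MonoidHom.mk' (fun n => P.loop e he n.toAdd) fun m n => P.loop_add e he m.toAdd n.toAdd
  have := map_zpow φ (Multiplicative.ofAdd 1) n
  rw [← ofAdd_zsmul] at this
  simpa [φ] using this

end CyclicPiece

/-- Two pieces that cover `X`. The matching pairs of points of the two coverings, that is the points
of the fibre product, are labelled by integers; the label is locally constant, the deck
transformations change it by `q` and `-p`, and the matching pairs with label zero are path
connected. -/
structure TorusGluing (X : Type) [TopologicalSpace X] (p q : ℤ) where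
  /-- the first piece -/
  P : CyclicPiece X
  /-- the second piece -/
  P' : CyclicPiece X
  /-- the label of a matching pair -/
  label : P.E → P'.E → ℤ
  isCoprime : IsCoprime p q
  cover : range P.f ∪ range P'.f = univ
  label_eventually : ∀ e e', P.f e = P'.f e' → ∀ᶠ w in 𝓝 (e, e'), P.f w.1 = P'.f w.2 →
    label w.1 w.2 = label e e'
  label_shift : ∀ e e' n m, P.f e = P'.f e' →
    label (P.shift n e) (P'.shift m e') = label e e' + q * m - p * n
  exists_matching : ∃ e e', P.f e = P'.f e' ∧ label e e' = 0
  joined : ∀ e₁ e₁' e₂ e₂', P.f e₁ = P'.f e₁' → P.f e₂ = P'.f e₂' → label e₁ e₁' = 0 →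
    label e₂ e₂' = 0 → ∃ (Γ : Path e₁ e₂) (Γ' : Path e₁' e₂'), ∀ t, P.f (Γ t) = P'.f (Γ' t)

namespace TorusGluing

variable {X : Type} [TopologicalSpace X] {p q : ℤ} (D : TorusGluing X p q)

/-- Two points of the intersection of the two pieces can be joined in the intersection. -/
theorem exists_label_zero {e : D.P.E} {e' : D.P'.E} (h : D.P.f e = D.P'.f e') :
    ∃ n m, D.label (D.P.shift n e) (D.P'.shift m e') = 0 := by
  obtain ⟨u, v, huv⟩ := D.isCoprime
  refine ⟨D.label e e' * u, -(D.label e e' * v), ?_⟩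
  rw [D.label_shift _ _ _ _ h]
  linear_combination -(D.label e e') * huv

/-- The loops in the two pieces, at a matching pair with label zero, generate the group. -/
theorem closure_loops {x₀ : X} {e₀ : D.P.E} {e₀' : D.P'.E} (h₀ : D.P.f e₀ = x₀)
    (h₀' : D.P'.f e₀' = x₀) (hl : D.label e₀ e₀' = 0) :
    Subgroup.closure {D.P.loop e₀ h₀ 1, D.P'.loop e₀' h₀' 1} = ⊤ := by
  set S := Subgroup.closure {D.P.loop e₀ h₀ 1, D.P'.loop e₀' h₀' 1} with hS
  have hU : ∀ n, D.P.loop e₀ h₀ n ∈ S := fun n => by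
    rw [D.P.loop_eq_zpow]
    exact S.zpow_mem (Subgroup.subset_closure (by simp)) n
  have hV : ∀ n, D.P'.loop e₀' h₀' n ∈ S := fun n => by
    rw [D.P'.loop_eq_zpow]
    exact S.zpow_mem (Subgroup.subset_closure (by simp)) n
  -- A path from the base point is good if it becomes an element of `S` by returning inside of
  -- a piece; it does not matter in which one.
  let goodU : ∀ x, Path.Homotopic.Quotient x₀ x → Prop := fun x c =>
    ∀ e (he : D.P.f e = x), FundamentalGroup.fromPath (c.trans (D.P.cls e e₀ he h₀)) ∈ S
  let goodV : ∀ x, Path.Homotopic.Quotient x₀ x → Prop := fun x c =>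
    ∀ e (he : D.P'.f e = x), FundamentalGroup.fromPath (c.trans (D.P'.cls e e₀' he h₀')) ∈ S
  have goodU_of : ∀ {x} (c : Path.Homotopic.Quotient x₀ x) e (he : D.P.f e = x),
      FundamentalGroup.fromPath (c.trans (D.P.cls e e₀ he h₀)) ∈ S → goodU x c := by
    intro x c e he hc e₁ he₁
    obtain ⟨n, rfl⟩ := D.P.exists_shift e e₁ (he.trans he₁.symm)
    have : c.trans (D.P.cls (D.P.shift n e) e₀ he₁ h₀) =
        (c.trans (D.P.cls e e₀ he h₀)).trans
          (D.P.cls e₀ (D.P.shift (-n) e₀) h₀ ((D.P.f_shift (-n) e₀).trans h₀)) := by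
      rw [Path.Homotopic.Quotient.trans_assoc, D.P.cls_trans]
      have h1 := D.P.cls_shift he₁ h₀ (-n)
      have h2 : D.P.shift (-n) (D.P.shift n e) = e := by
        rw [← D.P.shift_add, neg_add_cancel, D.P.shift_zero]
      rw [← h1]
      congr 1
      exact D.P.cls_congr h2 rfl _ _
    rw [this]
    exact S.mul_mem (hU (-n)) hc
  have goodV_of : ∀ {x} (c : Path.Homotopic.Quotient x₀ x) e (he : D.P'.f e = x),
      FundamentalGroup.fromPath (c.trans (D.P'.cls e e₀' he h₀')) ∈ S → goodV x c := by
    intro x c e he hc e₁ he₁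
    obtain ⟨n, rfl⟩ := D.P'.exists_shift e e₁ (he.trans he₁.symm)
    have : c.trans (D.P'.cls (D.P'.shift n e) e₀' he₁ h₀') =
        (c.trans (D.P'.cls e e₀' he h₀')).trans
          (D.P'.cls e₀' (D.P'.shift (-n) e₀') h₀' ((D.P'.f_shift (-n) e₀').trans h₀')) := by
      rw [Path.Homotopic.Quotient.trans_assoc, D.P'.cls_trans]
      have h1 := D.P'.cls_shift he₁ h₀' (-n)
      have h2 : D.P'.shift (-n) (D.P'.shift n e) = e := by
        rw [← D.P'.shift_add, neg_add_cancel, D.P'.shift_zero]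
      rw [← h1]
      congr 1
      exact D.P'.cls_congr h2 rfl _ _
    rw [this]
    exact S.mul_mem (hV (-n)) hc
  have good_iff : ∀ {x} (c : Path.Homotopic.Quotient x₀ x) e e', D.P.f e = x → D.P'.f e' = x →
      (goodU x c ↔ goodV x c) := by
    intro x c e e' he he'
    obtain ⟨n, m, hnm⟩ := D.exists_label_zero (he.trans he'.symm)
    have hn := (D.P.f_shift n e).trans he
    have hm := (D.P'.f_shift m e').trans he'
    obtain ⟨Γ, Γ', hΓ⟩ := D.joined _ _ e₀ e₀' (hn.trans hm.symm) (h₀.trans h₀'.symm) hnm hl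
    have h1 := D.P.mk_eq_cls hn h₀ ((Γ.map D.P.f.continuous).cast hn.symm h₀.symm) Γ
      fun t => rfl
    have h2 := D.P'.mk_eq_cls hm h₀' ((Γ.map D.P.f.continuous).cast hn.symm h₀.symm) Γ'
      fun t => (hΓ t).symm
    constructor
    · intro h
      refine goodV_of c _ hm ?_
      rw [← h2, h1]
      exact h _ hn
    · intro h
      refine goodU_of c _ hn ?_
      rw [← h1, h2]
      exact h _ hm
  have stepU : ∀ {x y} (c : Path.Homotopic.Quotient x₀ x) (γ : Path x y),
      (∀ t, γ t ∈ range D.P.f) → goodU x c → goodU y (c.trans (.mk γ)) := by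
    intro x y c γ hγ hc
    obtain ⟨e, he⟩ := hγ 0
    rw [γ.source] at he
    obtain ⟨e', Γ, hΓ⟩ := D.P.lift γ hγ e he
    have he' : D.P.f e' = y := by rw [← Γ.target, hΓ, γ.target]
    refine goodU_of _ e' he' ?_
    rw [D.P.mk_eq_cls he he' γ Γ hΓ, Path.Homotopic.Quotient.trans_assoc, D.P.cls_trans]
    exact hc e he
  have stepV : ∀ {x y} (c : Path.Homotopic.Quotient x₀ x) (γ : Path x y),
      (∀ t, γ t ∈ range D.P'.f) → goodV x c → goodV y (c.trans (.mk γ)) := by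
    intro x y c γ hγ hc
    obtain ⟨e, he⟩ := hγ 0
    rw [γ.source] at he
    obtain ⟨e', Γ, hΓ⟩ := D.P'.lift γ hγ e he
    have he' : D.P'.f e' = y := by rw [← Γ.target, hΓ, γ.target]
    refine goodV_of _ e' he' ?_
    rw [D.P'.mk_eq_cls he he' γ Γ hΓ, Path.Homotopic.Quotient.trans_assoc, D.P'.cls_trans]
    exact hc e he
  let good : ∀ x, Path.Homotopic.Quotient x₀ x → Prop := fun x c => goodU x c ∧ goodV x c
  have goodU_good : ∀ {x} (c : Path.Homotopic.Quotient x₀ x), x ∈ range D.P.f → goodU x c →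
      good x c := by
    rintro x c ⟨e, he⟩ hc
    refine ⟨hc, fun e' he' => ?_⟩
    exact ((good_iff c e e' he he').1 hc) e' he'
  have goodV_good : ∀ {x} (c : Path.Homotopic.Quotient x₀ x), x ∈ range D.P'.f → goodV x c →
      good x c := by
    rintro x c ⟨e', he'⟩ hc
    refine ⟨fun e he => ?_, hc⟩
    exact ((good_iff c e e' he he').2 hc) e he
  rw [eq_top_iff]
  rintro g -
  obtain ⟨γ, rfl⟩ := Path.Homotopic.Quotient.mk_surjective g
  obtain ⟨t, ht0, htm, ⟨n, htn⟩, htc⟩ := exists_monotone_Icc_subset_open_cover_unitInterval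
    (c := fun b : Bool => bif b then γ ⁻¹' range D.P.f else γ ⁻¹' range D.P'.f)
    (by
      rintro (_ | _)
      · exact D.P'.isOpen_range.preimage γ.continuous
      · exact D.P.isOpen_range.preimage γ.continuous)
    (by
      intro s _
      have : γ s ∈ range D.P.f ∪ range D.P'.f := D.cover ▸ mem_univ _
      rw [mem_iUnion]
      rcases this with h | h
      · exact ⟨true, h⟩
      · exact ⟨false, h⟩)
  have hgood : ∀ k, good (γ (t k)) (.mk ((γ.subpath 0 (t k)).cast γ.source.symm rfl)) := by
    intro k
    induction k with
    | zero =>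
      have hx : γ (t 0) = x₀ := by rw [ht0, γ.source]
      refine goodU_good _ ⟨e₀, h₀.trans hx.symm⟩ (goodU_of _ e₀ (h₀.trans hx.symm) ?_)
      have : (Path.Homotopic.Quotient.mk ((γ.subpath 0 (t 0)).cast γ.source.symm rfl)) =
          D.P.cls e₀ e₀ h₀ (h₀.trans hx.symm) := by
        refine D.P.mk_eq_cls _ _ _ (Path.refl e₀) fun s => ?_
        rw [ht0]
        simp [h₀]
      rw [this, D.P.cls_trans]
      have h1 := hU 0
      have h2 : D.P.shift 0 e₀ = e₀ := D.P.shift_zero e₀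
      unfold CyclicPiece.loop at h1
      convert! h1 using 3
      exact h2.symm
    | succ k ih =>
      have hle := htm k.le_succ
      have hcat : Path.Homotopic.Quotient.mk ((γ.subpath 0 (t (k + 1))).cast γ.source.symm rfl) =
          (Path.Homotopic.Quotient.mk ((γ.subpath 0 (t k)).cast γ.source.symm rfl)).trans
            (.mk (γ.subpath (t k) (t (k + 1)))) := by
        rw [← Path.Homotopic.Quotient.mk_trans, Path.Homotopic.Quotient.eq]
        have := Path.Homotopic.pathCast
          ⟨(Path.Homotopy.subpathTransSubpath γ 0 (t k) (t (k + 1))).symm⟩ γ.source.symm rfl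
        exact this
      have hmem : ∀ s, γ.subpath (t k) (t (k + 1)) s ∈ γ '' Icc (t k) (t (k + 1)) := by
        intro s
        rw [← Path.range_subpath_of_le _ _ _ hle]
        exact mem_range_self s
      rw [hcat]
      obtain ⟨b, hb⟩ := htc k
      cases b with
      | true =>
        have hr : ∀ s, γ.subpath (t k) (t (k + 1)) s ∈ range D.P.f := fun s => by
          obtain ⟨r, hr, hrs⟩ := hmem s
          rw [← hrs]
          exact hb hr
        refine goodU_good _ ?_ (stepU _ _ hr ih.1)
        exact hb ⟨hle, le_rfl⟩
      | false =>
        have hr : ∀ s, γ.subpath (t k) (t (k + 1)) s ∈ range D.P'.f := fun s => by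
          obtain ⟨r, hr, hrs⟩ := hmem s
          rw [← hrs]
          exact hb hr
        refine goodV_good _ ?_ (stepV _ _ hr ih.2)
        exact hb ⟨hle, le_rfl⟩
  have hn := (hgood n).1
  have hx : γ (t n) = x₀ := by rw [htn n le_rfl, γ.target]
  have h1 := hn (D.P.shift 0 e₀) ((D.P.f_shift 0 e₀).trans (h₀.trans hx.symm))
  have h2 := S.mul_mem (hU 0) h1
  rw [FundamentalGroup.mul_def] at h2
  convert! h1 using 1
  have h3 : D.P.cls (D.P.shift 0 e₀) e₀ ((D.P.f_shift 0 e₀).trans (h₀.trans hx.symm)) h₀ =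
      .mk ((Path.refl x₀).cast hx rfl) := by
    symm
    refine D.P.mk_eq_cls _ _ _ ((Path.refl e₀).cast (D.P.shift_zero e₀) rfl) fun s => ?_
    simp [h₀]
  unfold FundamentalGroup.fromPath
  rw [h3, ← Path.Homotopic.Quotient.mk_trans]
  symm
  refine Path.Homotopic.Quotient.eq.2 ?_
  have key : ∀ (s : unitInterval) (hs : s = 1) (hx : γ s = x₀),
      (((γ.subpath 0 s).cast γ.source.symm rfl).trans ((Path.refl x₀).cast hx rfl)).Homotopic
        γ := by
    intro s hs hx
    subst hs
    have : (((γ.subpath 0 1).cast γ.source.symm rfl).trans ((Path.refl x₀).cast hx rfl)) =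
        γ.trans (Path.refl x₀) := by
      ext r
      simp [Path.trans_apply]
    rw [this]
    exact ⟨Path.Homotopy.transRefl γ⟩
  exact key _ (htn n le_rfl) hx

end TorusGluing

/-! ### Homomorphisms out of the fundamental group -/

/-- The change of frame between the two pieces as a function of the label. Two pairs `(n, m)` with
the same value of `q * m - p * n` differ by a multiple of `(q, p)`, so the relation makes it well
defined. -/
theorem exists_label_hom {H : Type} [Group H] {p q : ℤ} (hpq : IsCoprime p q) {x y : H}
    (hxy : x ^ q = y ^ p) : ∃ g : ℤ → H, g 0 = 1 ∧
      ∀ k n m : ℤ, g (k + q * m - p * n) = y ^ (-m) * g k * x ^ n := by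
  obtain ⟨u, v, huv⟩ := hpq
  have key : ∀ k m n : ℤ, q * m - p * n = k →
      y ^ (-(k * v)) * x ^ (-(k * u)) = y ^ (-m) * x ^ n := by
    intro k m n hk
    obtain ⟨l, hl⟩ : ∃ l, l = u * (m - k * v) + v * (n + k * u) := ⟨_, rfl⟩
    have hm : m = k * v + p * l := by
      rw [hl]; linear_combination -m * huv + v * hk
    have hn : n = q * l + -(k * u) := by
      rw [hl]; linear_combination -n * huv - u * hk
    rw [hm, hn, neg_add, zpow_add, zpow_add, show -(p * l) = p * (-l) by ring, zpow_mul, ← hxy,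
      zpow_mul x q l]
    group
  refine ⟨fun k => y ^ (-(k * v)) * x ^ (-(k * u)), by simp, fun k n m => ?_⟩
  have h2 : q * (m + k * v) - p * (n - k * u) = k + q * m - p * n := by
    linear_combination k * huv
  simp only
  rw [key _ _ _ h2, neg_add, zpow_add, sub_eq_add_neg, add_comm n, zpow_add]
  group

namespace TorusGluing

variable {X : Type} [TopologicalSpace X] {p q : ℤ} (D : TorusGluing X p q)

/-- Elements with `x ^ q = y ^ p` define frames on both coverings that change by `x` and `y` under
the deck transformations, and by a function of the label between matching points. -/
theorem exists_frames {H : Type} [Group H] {x y : H} (hxy : x ^ q = y ^ p) :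
    ∃ (g : ℤ → H) (ψ : D.P.E → H) (ψ' : D.P'.E → H), g 0 = 1 ∧
      (∀ e n, ψ (D.P.shift n e) = ψ e * x ^ n) ∧ (∀ e n, ψ' (D.P'.shift n e) = ψ' e * y ^ n) ∧
      ∀ e e', D.P.f e = D.P'.f e' → ψ e = ψ' e' * g (D.label e e') := by
  classical
  obtain ⟨g, hg0, hg⟩ := exists_label_hom D.isCoprime hxy
  have : Nonempty D.P.E := inferInstance
  have : Nonempty D.P'.E := inferInstance
  let s : X → D.P.E := Function.invFun D.P.f
  let s' : X → D.P'.E := Function.invFun D.P'.f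
  have hs : ∀ e, D.P.f (s (D.P.f e)) = D.P.f e := fun e => Function.invFun_eq ⟨e, rfl⟩
  have hs' : ∀ e, D.P'.f (s' (D.P'.f e)) = D.P'.f e := fun e => Function.invFun_eq ⟨e, rfl⟩
  choose a ha using fun e => D.P.exists_shift _ e (hs e)
  choose b hb using fun e => D.P'.exists_shift _ e (hs' e)
  have ha_shift : ∀ e n, a (D.P.shift n e) = a e + n := by
    intro e n
    have h := ha (D.P.shift n e)
    rw [D.P.f_shift] at h
    conv_lhs at h => rw [ha e, ← D.P.shift_add]
    have := D.P.shift_inj h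
    omega
  have hb_shift : ∀ e n, b (D.P'.shift n e) = b e + n := by
    intro e n
    have h := hb (D.P'.shift n e)
    rw [D.P'.f_shift] at h
    conv_lhs at h => rw [hb e, ← D.P'.shift_add]
    have := D.P'.shift_inj h
    omega
  refine ⟨g, fun e => x ^ a e, fun e' => if ∃ e, D.P.f e = D.P'.f e' then
    (g (D.label (s (D.P'.f e')) e'))⁻¹ else y ^ b e', hg0, ?_, ?_, ?_⟩
  · intro e n
    simp only [ha_shift, zpow_add]
  · intro e' n
    simp only [D.P'.f_shift]
    split_ifs with h
    · obtain ⟨e, he⟩ := h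
      have h1 := D.label_shift (s (D.P'.f e')) e' 0 n (by rw [← he, hs])
      rw [D.P.shift_zero] at h1
      rw [h1, hg]
      group
    · rw [hb_shift, zpow_add]
  · intro e e' h
    simp only
    rw [if_pos ⟨e, h⟩]
    have h1 := D.label_shift (s (D.P'.f e')) e' (a e) 0 (by rw [← h, hs])
    rw [D.P'.shift_zero, ← h, ← ha e] at h1
    rw [h1, hg, ← h]
    group

/-- Left multiplication makes `H` a fibre; the monodromy of the covering glued from the two frames
sends the two loops to conjugates of `x` and `y`. -/
theorem exists_hom {x₀ : X} {e₀ : D.P.E} {e₀' : D.P'.E} (h₀ : D.P.f e₀ = x₀)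
    (h₀' : D.P'.f e₀' = x₀) (hl : D.label e₀ e₀' = 0) {H : Type} [Group H] {x y : H}
    (hxy : x ^ q = y ^ p) : ∃ ρ : FundamentalGroup X x₀ →* H,
      ρ (D.P.loop e₀ h₀ 1) = x ∧ ρ (D.P'.loop e₀' h₀' 1) = y := by
  obtain ⟨g, ψ, ψ', hg0, hψ, hψ', hgl⟩ := D.exists_frames hxy
  let π : C(D.P.E ⊕ D.P'.E, X) := ⟨Sum.elim D.P.f D.P'.f, by fun_prop⟩
  let S := MulAction.toPermHom H H
  let Ψ : D.P.E ⊕ D.P'.E → H := Sum.elim ψ ψ'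
  have hsec : ∀ x, ∃ (O : Set X) (σ : X → D.P.E ⊕ D.P'.E), IsOpen O ∧ x ∈ O ∧ ContinuousOn σ O ∧
      ∀ x' ∈ O, π (σ x') = x' := by
    intro x
    have : x ∈ range D.P.f ∪ range D.P'.f := D.cover ▸ mem_univ x
    rcases this with ⟨e, rfl⟩ | ⟨e, rfl⟩
    · obtain ⟨O, σ, hO, he, hσ, h⟩ := D.P.localSection e
      exact ⟨O, Sum.inl ∘ σ, hO, he, continuous_inl.comp_continuousOn hσ, h⟩
    · obtain ⟨O, σ, hO, he, hσ, h⟩ := D.P'.localSection e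
      exact ⟨O, Sum.inr ∘ σ, hO, he, continuous_inr.comp_continuousOn hσ, h⟩
  have hΨ : ∀ z z', π z = π z' → ∀ᶠ w in 𝓝 (z, z'), π w.1 = π w.2 →
      (S (Ψ w.2))⁻¹ * S (Ψ w.1) = (S (Ψ z'))⁻¹ * S (Ψ z) := by
    have hdeck : ∀ (P : CyclicPiece X) (z : H) (φ : P.E → H),
        (∀ e n, φ (P.shift n e) = φ e * z ^ n) → ∀ e e', P.f e = P.f e' →
        ∀ᶠ w in 𝓝 (e, e'), P.f w.1 = P.f w.2 →
          (S (φ w.2))⁻¹ * S (φ w.1) = (S (φ e'))⁻¹ * S (φ e) := by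
      intro P z φ hφ e e' h
      obtain ⟨n, rfl⟩ := P.exists_shift e e' h
      obtain ⟨N, hN, hinj⟩ := P.locInj (P.shift n e)
      have h1 : ∀ᶠ w : P.E × P.E in 𝓝 (e, P.shift n e), w.2 ∈ N :=
        (continuous_snd.tendsto (e, P.shift n e)).eventually hN
      have h2 : ∀ᶠ w : P.E × P.E in 𝓝 (e, P.shift n e), P.shift n w.1 ∈ N :=
        (((P.shift n).continuous.comp continuous_fst).tendsto (e, P.shift n e)).eventually hN
      filter_upwards [h1, h2] with w hw1 hw2 hw
      have : w.2 = P.shift n w.1 := hinj hw1 hw2 (by rw [P.f_shift, hw])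
      rw [this, hφ, hφ]
      simp only [← map_inv, ← map_mul]
      congr 1
      group
    rintro (e | e) (e' | e') h <;>
      rw [nhds_prod_eq] <;>
      simp only [nhds_inl, nhds_inr, Filter.prod_map_map_eq, eventually_map] <;>
      rw [← nhds_prod_eq]
    · exact hdeck D.P x ψ hψ e e' h
    · have h' : D.P.f e = D.P'.f e' := h
      filter_upwards [D.label_eventually e e' h] with w hw hw'
      have hw'' : D.P.f w.1 = D.P'.f w.2 := hw'
      change (S (ψ' w.2))⁻¹ * S (ψ w.1) = (S (ψ' e'))⁻¹ * S (ψ e)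
      rw [hgl _ _ hw'', hgl _ _ h', hw hw'']
      simp only [← map_inv, ← map_mul]
      congr 1
      group
    · have h' : D.P.f e' = D.P'.f e := h.symm
      have := (continuous_swap.tendsto (e, e')).eventually (D.label_eventually e' e h')
      filter_upwards [this] with w hw hw'
      have hw'' : D.P.f w.2 = D.P'.f w.1 := hw'.symm
      have hw2 : D.label w.2 w.1 = D.label e' e := hw hw''
      change (S (ψ w.2))⁻¹ * S (ψ' w.1) = (S (ψ e'))⁻¹ * S (ψ' e)
      rw [hgl _ _ hw'', hgl _ _ h', hw2]
      simp only [← map_inv, ← map_mul]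
      congr 1
      group
    · exact hdeck D.P' y ψ' hψ' e e' h
  obtain ⟨ρ, hρ⟩ := exists_monodromy π hsec (fun z => S (Ψ z)) hΨ x₀
  have hSinj : Function.Injective S := MulAction.toPerm_injective
  have hloop : ∀ (P : CyclicPiece X) e (he : P.f e = x₀), ∃ (γ : Path x₀ x₀)
      (Γ : Path e (P.shift 1 e)), (∀ t, P.f (Γ t) = γ t) ∧
      P.loop e he 1 = FundamentalGroup.fromPath (Path.Homotopic.Quotient.mk γ) := fun P e he =>
    ⟨_, PathConnectedSpace.somePath e (P.shift 1 e), fun t => rfl, rfl⟩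
  have hρa : ρ (D.P.loop e₀ h₀ 1) = S (ψ e₀ * x * (ψ e₀)⁻¹) := by
    obtain ⟨γ, Γ, h1, h2⟩ := hloop D.P e₀ h₀
    rw [h2, hρ γ _ _ (Γ.map continuous_inl) h1, ← map_inv, ← map_mul]
    change S (ψ _ * (ψ _)⁻¹) = _
    rw [hψ, zpow_one]
  have hρb : ρ (D.P'.loop e₀' h₀' 1) = S (ψ e₀ * y * (ψ e₀)⁻¹) := by
    obtain ⟨γ, Γ, h1, h2⟩ := hloop D.P' e₀' h₀'
    rw [h2, hρ γ _ _ (Γ.map continuous_inr) h1, ← map_inv, ← map_mul]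
    change S (ψ' _ * (ψ' _)⁻¹) = _
    rw [hψ', zpow_one, hgl e₀ e₀' (h₀.trans h₀'.symm), hl, hg0, mul_one]
  -- The monodromy of the generators consists of left translations of `H`.
  have hrange : ∀ z, ρ z ∈ S.range := by
    have : Subgroup.closure {D.P.loop e₀ h₀ 1, D.P'.loop e₀' h₀' 1} ≤ S.range.comap ρ := by
      rw [Subgroup.closure_le]
      rintro _ (rfl | rfl)
      · exact ⟨_, hρa.symm⟩
      · exact ⟨_, hρb.symm⟩
    intro z
    exact this (D.closure_loops h₀ h₀' hl ▸ Subgroup.mem_top z)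
  let ρ' : FundamentalGroup X x₀ →* H :=
    ((MonoidHom.ofInjective hSinj).symm.toMonoidHom).comp (ρ.codRestrict S.range hrange)
  have hρ' : ∀ z h, ρ z = S h → ρ' z = h := by
    intro z h hz
    change (MonoidHom.ofInjective hSinj).symm _ = h
    rw [MulEquiv.symm_apply_eq]
    exact Subtype.ext hz
  refine ⟨(MulAut.conj (ψ e₀)⁻¹).toMonoidHom.comp ρ', ?_, ?_⟩
  · change MulAut.conj (ψ e₀)⁻¹ (ρ' _) = x
    rw [hρ' _ _ hρa, MulAut.conj_apply]
    group
  · change MulAut.conj (ψ e₀)⁻¹ (ρ' _) = y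
    rw [hρ' _ _ hρb, MulAut.conj_apply]
    group

theorem isTorusGroup (D : TorusGluing X p q) :
    ∃ x₀ : X, IsTorusGroup (FundamentalGroup X x₀) p q := by
  obtain ⟨e₀, e₀', h, hl⟩ := D.exists_matching
  refine ⟨D.P.f e₀, D.P.loop e₀ rfl 1, D.P'.loop e₀' h.symm 1, D.closure_loops rfl h.symm hl, ?_,
    fun H _ x y hxy => D.exists_hom rfl h.symm hl hxy⟩
  rw [← D.P.loop_eq_zpow, ← D.P'.loop_eq_zpow]
  -- The matching paths from a pair to its translate by `(q, p)` have the same image.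
  have hq := D.P.f_shift q e₀
  have hp := D.P'.f_shift p e₀'
  obtain ⟨Γ, Γ', hΓ⟩ := D.joined e₀ e₀' (D.P.shift q e₀) (D.P'.shift p e₀') h
    (hq.trans (h.trans hp.symm)) hl (by rw [D.label_shift _ _ _ _ h, hl]; ring)
  let γ : Path (D.P.f e₀) (D.P.f e₀) := (Γ.map D.P.f.continuous).cast rfl hq.symm
  exact (D.P.mk_eq_cls rfl hq γ Γ fun t => rfl).symm.trans
    (D.P'.mk_eq_cls h.symm (hp.trans h.symm) γ Γ' fun t => (hΓ t).symm)

end TorusGluing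

/-! ### The two solid tori in the complement of a curve on the torus -/

/-- The point of the unit circle with angle `t`, where the full angle is `1`. -/
noncomputable def circ (t : ℝ) : ℂ := Complex.exp (2 * Real.pi * t * Complex.I)

theorem circ_eq (t : ℝ) : circ t = Complex.exp ((2 * Real.pi * t : ℝ) * Complex.I) := by
  rw [circ]; push_cast; ring_nf

@[fun_prop]
theorem continuous_circ : Continuous circ := by
  unfold circ
  fun_prop

@[simp]
theorem norm_circ (t : ℝ) : ‖circ t‖ = 1 := by
  rw [circ_eq, Complex.norm_exp_ofReal_mul_I]

theorem circ_add (s t : ℝ) : circ (s + t) = circ s * circ t := by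
  rw [circ, circ, circ, ← Complex.exp_add]; push_cast; ring_nf

theorem circ_eq_circ_iff {s t : ℝ} : circ s = circ t ↔ ∃ n : ℤ, s = t + n := by
  rw [circ, circ, Complex.exp_eq_exp_iff_exists_int]
  have hpi : (2 * Real.pi * Complex.I : ℂ) ≠ 0 := Complex.two_pi_I_ne_zero
  refine exists_congr fun n => ⟨fun h => ?_, fun h => ?_⟩
  · have : (s : ℂ) = t + n := by
      apply mul_left_cancel₀ hpi
      linear_combination h
    exact_mod_cast this
  · rw [h]; push_cast; ring

@[simp]
theorem circ_add_int (t : ℝ) (n : ℤ) : circ (t + n) = circ t :=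
  circ_eq_circ_iff.2 ⟨n, rfl⟩

theorem norm_mul_circ_arg (z : ℂ) : ‖z‖ * circ (z.arg / (2 * Real.pi)) = z := by
  rw [circ_eq, mul_div_cancel₀ _ (by positivity), Complex.norm_mul_exp_arg_mul_I]

theorem torusPoint_val (x y : ℝ) :
    (torusPoint x y).1 = (circ x / (Real.sqrt 2 : ℂ), circ y / (Real.sqrt 2 : ℂ)) := rfl

theorem sqrt_two_ne_zero : (Real.sqrt 2 : ℂ) ≠ 0 := by
  exact_mod_cast (Real.sqrt_pos.2 two_pos).ne'

theorem torusPoint_eq_iff {x y x' y' : ℝ} :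
    torusPoint x y = torusPoint x' y' ↔ (∃ m : ℤ, x = x' + m) ∧ ∃ n : ℤ, y = y' + n := by
  rw [Subtype.ext_iff, torusPoint_val, torusPoint_val, Prod.mk.injEq,
    div_left_inj' sqrt_two_ne_zero, div_left_inj' sqrt_two_ne_zero, circ_eq_circ_iff,
    circ_eq_circ_iff]

theorem torusPoint_congr {x y x' y' : ℝ} (hx : circ x = circ x') (hy : circ y = circ y') :
    torusPoint x y = torusPoint x' y' :=
  Subtype.ext (by rw [torusPoint_val, torusPoint_val, hx, hy])

@[fun_prop]
theorem continuous_torusPoint : Continuous fun s : ℝ × ℝ => torusPoint s.1 s.2 := by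
  refine Continuous.subtype_mk ?_ _
  fun_prop

theorem circ_arg_eq {z : ℂ} {x r : ℝ} (hr : 0 < r) (hz : z = r * circ x) :
    circ (z.arg / (2 * Real.pi)) = circ x := by
  have hnz : ‖z‖ = r := by
    rw [hz, norm_mul, norm_circ, Complex.norm_real, Real.norm_of_nonneg hr.le, mul_one]
  have h := norm_mul_circ_arg z
  rw [hnz] at h
  have hr' : (r : ℂ) ≠ 0 := by exact_mod_cast hr.ne'
  exact mul_left_cancel₀ hr' (h.trans hz)

/-- The universal covering of a part of the complement of a curve `K` on the standard torus, in
the coordinates `z` and the angle of `w`. The part consists of the open solid torus `|z| < |w|`,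
that is `2 * |z| ^ 2 < 1`, together with all points off the cores whose projection to the torus is not
on `K`. -/
def coverSet (K : Set S3) : Set (ℂ × ℝ) :=
  {d | ‖d.1‖ < 1 ∧ (2 * ‖d.1‖ ^ 2 < 1 ∨
    (d.1 ≠ 0 ∧ torusPoint (d.1.arg / (2 * Real.pi)) d.2 ∉ K))}

theorem isOpen_coverSet {K : Set S3} (hK : IsClosed K) : IsOpen (coverSet K) := by
  have h1 : IsOpen {d : ℂ × ℝ | ‖d.1‖ < 1} := isOpen_lt (by fun_prop) continuous_const
  have h2 : IsOpen {d : ℂ × ℝ | 2 * ‖d.1‖ ^ 2 < 1} := isOpen_lt (by fun_prop) continuous_const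
  have h0 : IsOpen {d : ℂ × ℝ | d.1 ≠ 0} := isOpen_ne_fun (by fun_prop) continuous_const
  have h3 : ContinuousOn (fun d : ℂ × ℝ => torusPoint (d.1.arg / (2 * Real.pi)) d.2)
      {d | d.1 ≠ 0} := by
    refine (Topology.IsInducing.continuousOn_iff (g := (Subtype.val : S3 → ℂ × ℂ))
      .subtypeVal).2 ?_
    have : ContinuousOn (fun d : ℂ × ℝ =>
        (d.1 / ‖d.1‖ / (Real.sqrt 2 : ℂ), circ d.2 / (Real.sqrt 2 : ℂ))) {d | d.1 ≠ 0} := by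
      refine ContinuousOn.prodMk (ContinuousOn.div_const (ContinuousOn.div (by fun_prop)
        (by fun_prop) fun d hd => ?_) _) (by fun_prop)
      exact_mod_cast norm_ne_zero_iff.2 hd
    refine this.congr fun d hd => ?_
    have hd' : (‖d.1‖ : ℂ) ≠ 0 := by exact_mod_cast norm_ne_zero_iff.2 hd
    simp only [Function.comp, torusPoint_val, Prod.mk.injEq, and_true]
    congr 1
    rw [eq_div_iff hd', mul_comm, norm_mul_circ_arg]
  have h4 := h3.isOpen_inter_preimage h0 hK.isOpen_compl
  exact h1.inter (h2.union h4)

/-- The point with first coordinate `z` for which the second coordinate has the angle `y`. -/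
noncomputable def coverPoint (d : ℂ × ℝ) (hd : ‖d.1‖ < 1) : S3 :=
  ⟨(d.1, (Real.sqrt (1 - ‖d.1‖ ^ 2) : ℂ) * circ d.2), by
    have : 0 ≤ 1 - ‖d.1‖ ^ 2 := by nlinarith [norm_nonneg d.1]
    simp only [norm_mul, norm_circ, Complex.norm_real, Real.norm_eq_abs, mul_one, sq_abs,
      Real.sq_sqrt this]
    ring⟩

theorem sqrt_pos_of_lt_one {z : ℂ} (hz : ‖z‖ < 1) : 0 < Real.sqrt (1 - ‖z‖ ^ 2) :=
  Real.sqrt_pos.2 (by nlinarith [norm_nonneg z])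

theorem coverPoint_eq_iff {d d' : ℂ × ℝ} (hd : ‖d.1‖ < 1) (hd' : ‖d'.1‖ < 1) :
    coverPoint d hd = coverPoint d' hd' ↔ d.1 = d'.1 ∧ ∃ n : ℤ, d.2 = d'.2 + n := by
  rw [Subtype.ext_iff, coverPoint, coverPoint, Prod.mk.injEq, ← circ_eq_circ_iff]
  refine and_congr_right fun h => ?_
  have : (Real.sqrt (1 - ‖d.1‖ ^ 2) : ℂ) ≠ 0 := by exact_mod_cast (sqrt_pos_of_lt_one hd).ne'
  rw [← h, mul_right_inj' this]

theorem norm_snd_eq (x : S3) : ‖x.1.2‖ = Real.sqrt (1 - ‖x.1.1‖ ^ 2) := by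
  rw [show 1 - ‖x.1.1‖ ^ 2 = ‖x.1.2‖ ^ 2 by linarith [x.2], Real.sqrt_sq (norm_nonneg _)]

theorem coverPoint_eq {x : S3} {y : ℝ} (hx : ‖x.1.1‖ < 1) (hy : x.1.2 = ‖x.1.2‖ * circ y) :
    coverPoint (x.1.1, y) hx = x := by
  refine Subtype.ext (Prod.ext rfl ?_)
  change (Real.sqrt (1 - ‖x.1.1‖ ^ 2) : ℂ) * circ y = _
  rw [← norm_snd_eq, ← hy]

theorem torusPoint_arg {x : S3} (hx : ‖x.1.1‖ = ‖x.1.2‖) {y : ℝ} (hy : x.1.2 = ‖x.1.2‖ * circ y) :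
    torusPoint (x.1.1.arg / (2 * Real.pi)) y = x := by
  have h : ‖x.1.1‖ = (Real.sqrt 2)⁻¹ := by
    rw [← Real.sqrt_inv, eq_comm, Real.sqrt_eq_iff_mul_self_eq_of_pos]
    · have := x.2
      rw [← hx] at this
      linarith
    · have := x.2
      rw [← hx] at this
      by_contra h
      have h0 : ‖x.1.1‖ = 0 := le_antisymm (not_lt.1 h) (norm_nonneg _)
      rw [h0] at this
      norm_num at this
  have h1 := norm_mul_circ_arg x.1.1
  rw [h] at h1
  rw [← hx, h] at hy
  refine Subtype.ext (Prod.ext ?_ ?_)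
  · refine Eq.trans ?_ h1
    rw [torusPoint_val]
    push_cast
    rw [mul_comm _ (circ _), ← div_eq_mul_inv]
  · rw [torusPoint_val, hy]
    simp only [div_eq_mul_inv]
    push_cast
    rw [mul_comm]

theorem coverPoint_notMem {K : Set S3} (hK : ∀ x ∈ K, ‖x.1.1‖ = ‖x.1.2‖) {d : ℂ × ℝ}
    (hd : d ∈ coverSet K) : coverPoint d hd.1 ∉ K := by
  intro hmem
  have heq := hK _ hmem
  have hw : (coverPoint d hd.1).1.2 = ‖(coverPoint d hd.1).1.2‖ * circ d.2 := by
    rw [norm_snd_eq]; rfl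
  rcases hd.2 with h | h
  · have := (coverPoint d hd.1).2
    rw [← heq] at this
    change ‖d.1‖ ^ 2 + ‖d.1‖ ^ 2 = 1 at this
    linarith
  · apply h.2
    have := torusPoint_arg heq hw
    change torusPoint (d.1.arg / (2 * Real.pi)) d.2 = _ at this
    rw [this]
    exact hmem

theorem coverSet_of_circ_eq {K : Set S3} {z : ℂ} {y y' : ℝ} (h : (z, y) ∈ coverSet K)
    (hy : circ y = circ y') : (z, y') ∈ coverSet K := by
  refine ⟨h.1, h.2.imp_right fun h' => ⟨h'.1, ?_⟩⟩
  rw [torusPoint_congr rfl hy.symm]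
  exact h'.2

/-- Scaling the first coordinate to zero retracts the covering to a line, since it preserves the
projection to the torus. -/
theorem contractible_coverSet (K : Set S3) : ContractibleSpace (coverSet K) := by
  rw [contractible_iff_id_nullhomotopic]
  have h0 : ∀ y : ℝ, ((0, y) : ℂ × ℝ) ∈ coverSet K := fun y =>
    ⟨by simp, Or.inl (by simp)⟩
  let pr : C(coverSet K, ℝ) := ⟨fun d => d.1.2, by fun_prop⟩
  let i : C(ℝ, coverSet K) := ⟨fun y => ⟨(0, y), h0 y⟩, by fun_prop⟩
  have hnull : (i.comp ((ContinuousMap.id ℝ).comp pr)).Nullhomotopic :=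
    ((id_nullhomotopic ℝ).comp_left pr).comp_right i
  obtain ⟨y, hy⟩ := hnull
  refine ⟨y, ContinuousMap.Homotopic.trans ⟨?_⟩ hy⟩
  have hmem : ∀ (s : unitInterval) (d : coverSet K),
      ((((1 - s : ℝ) : ℂ) * d.1.1, d.1.2) : ℂ × ℝ) ∈ coverSet K := by
    intro s d
    have hs1 : (0 : ℝ) ≤ 1 - s := by linarith [s.2.2]
    have hs2 : (1 : ℝ) - s ≤ 1 := by linarith [s.2.1]
    have hn : ‖((1 - s : ℝ) : ℂ) * d.1.1‖ ≤ ‖d.1.1‖ := by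
      rw [norm_mul, Complex.norm_real, Real.norm_of_nonneg hs1]
      exact mul_le_of_le_one_left (norm_nonneg _) hs2
    refine ⟨hn.trans_lt d.2.1, ?_⟩
    rcases hs1.eq_or_lt with hs | hs
    · left
      rw [← hs]; simp
    · rcases d.2.2 with h | h
      · left
        have := pow_le_pow_left₀ (norm_nonneg _) hn 2
        change 2 * ‖((1 - s : ℝ) : ℂ) * d.1.1‖ ^ 2 < 1
        linarith
      · right
        refine ⟨mul_ne_zero (by exact_mod_cast hs.ne') h.1, ?_⟩
        change torusPoint ((((1 - s : ℝ) : ℂ) * d.1.1).arg / (2 * Real.pi)) d.1.2 ∉ K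
        rw [Complex.arg_real_mul _ hs]
        exact h.2
  exact
    { toFun := fun w => ⟨_, hmem w.1 w.2⟩
      continuous_toFun := by fun_prop
      map_zero_left := fun d => Subtype.ext (by simp)
      map_one_left := fun d => Subtype.ext (by simp [i, pr]) }

/-- The complement of a subset of the three-sphere. -/
abbrev Compl (K : Set S3) : Type := {x : S3 // x ∉ K}

/-- The piece around the core circle `z = 0` of the complement of a closed subset of the torus. -/
noncomputable def solidPiece (K : Set S3) (hcl : IsClosed K) (hK : ∀ x ∈ K, ‖x.1.1‖ = ‖x.1.2‖) :
    CyclicPiece (Compl K) where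
  E := coverSet K
  simplyConnected := by
    have := contractible_coverSet K
    infer_instance
  f := ⟨fun d => ⟨coverPoint d.1 d.2.1, coverPoint_notMem hK d.2⟩, by
    refine Continuous.subtype_mk (Continuous.subtype_mk ?_ _) _
    fun_prop⟩
  shift n := ⟨fun d => ⟨(d.1.1, d.1.2 + n), coverSet_of_circ_eq d.2 (circ_add_int _ n).symm⟩, by
    fun_prop⟩
  shift_zero d := Subtype.ext (by simp)
  shift_add m n d := Subtype.ext (Prod.ext rfl (by simp; ring))
  shift_free n d h := by
    have := congrArg (fun d : coverSet K => d.1.2) h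
    simpa using this
  f_shift n d :=
    Subtype.ext ((coverPoint_eq_iff (d := (d.1.1, d.1.2 + n)) d.2.1 d.2.1).2 ⟨rfl, n, rfl⟩)
  exists_shift d d' h := by
    have h' := congrArg Subtype.val h.symm
    obtain ⟨h1, n, hn⟩ := (coverPoint_eq_iff d'.2.1 d.2.1).1 h'
    exact ⟨n, Subtype.ext (Prod.ext h1 hn)⟩
  lift {x y} γ hγ e he := by
    have hw : ∀ t, (γ t).1.1.2 ≠ 0 := by
      intro t
      obtain ⟨d, hd⟩ := hγ t
      rw [← hd]
      refine mul_ne_zero ?_ (norm_ne_zero_iff.1 (by rw [norm_circ]; exact one_ne_zero))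
      exact_mod_cast (sqrt_pos_of_lt_one d.2.1).ne'
    let δ : C(unitInterval, Circle) :=
      ⟨fun t => ⟨(γ t).1.1.2 / ‖(γ t).1.1.2‖, by
        refine mem_sphere_zero_iff_norm.2 ?_
        rw [norm_div, Complex.norm_real, norm_norm, div_self (norm_ne_zero_iff.2 (hw t))]⟩, by
        refine Continuous.subtype_mk (Continuous.div (by fun_prop) (by fun_prop) fun t => ?_) _
        exact_mod_cast norm_ne_zero_iff.2 (hw t)⟩
    have hexp : ∀ s : ℝ, (Circle.exp (2 * Real.pi * s) : ℂ) = circ s := fun s => by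
      rw [circ_eq, Circle.coe_exp]
    have hδ : ∀ t s, δ t = Circle.exp (2 * Real.pi * s) ↔
        (γ t).1.1.2 = ‖(γ t).1.1.2‖ * circ s := by
      intro t s
      rw [Circle.ext_iff, hexp]
      change (γ t).1.1.2 / ‖(γ t).1.1.2‖ = circ s ↔ _
      rw [div_eq_iff (by exact_mod_cast norm_ne_zero_iff.2 (hw t)), mul_comm]
    have hd2 : ∀ (d : coverSet K) t, (⟨coverPoint d.1 d.2.1, coverPoint_notMem hK d.2⟩ : Compl K)
        = γ t → (γ t).1.1.2 = ‖(γ t).1.1.2‖ * circ d.1.2 := by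
      intro d t h
      rw [← h]
      change _ = (‖(coverPoint d.1 d.2.1).1.2‖ : ℂ) * _
      rw [norm_snd_eq]
      rfl
    have he' : (⟨coverPoint e.1 e.2.1, coverPoint_notMem hK e.2⟩ : Compl K) = γ 0 := by
      rw [γ.source]; exact he
    obtain ⟨Γ, hΓ, hΓ0⟩ := Circle.isCoveringMap_exp.exists_path_lifts δ (2 * Real.pi * e.1.2)
      ((hδ 0 _).2 (hd2 e 0 he'))
    have hpi : (2 * Real.pi : ℝ) ≠ 0 := by positivity
    have hΓ' : ∀ t, (γ t).1.1.2 = ‖(γ t).1.1.2‖ * circ (Γ t / (2 * Real.pi)) := by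
      intro t
      rw [← hδ, mul_div_cancel₀ _ hpi]
      exact (congrFun hΓ t).symm
    have hmem : ∀ t, ((γ t).1.1.1, Γ t / (2 * Real.pi)) ∈ coverSet K := by
      intro t
      obtain ⟨d, hd⟩ := hγ t
      have h1 := hd2 d t hd
      have h2 : d.1.1 = (γ t).1.1.1 := by rw [← hd]; rfl
      refine coverSet_of_circ_eq (y := d.1.2) (by rw [← h2]; exact d.2) ?_
      have h3 : (‖(γ t).1.1.2‖ : ℂ) ≠ 0 := by exact_mod_cast norm_ne_zero_iff.2 (hw t)
      exact mul_left_cancel₀ h3 (h1.symm.trans (hΓ' t))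
    refine ⟨⟨_, hmem 1⟩, ⟨⟨fun t => ⟨_, hmem t⟩, by fun_prop⟩, ?_, rfl⟩, fun t => ?_⟩
    · refine Subtype.ext (Prod.ext ?_ ?_)
      · change (γ 0).1.1.1 = _
        rw [← he']; rfl
      · change Γ 0 / (2 * Real.pi) = _
        rw [hΓ0, mul_div_cancel_left₀ _ hpi]
    · exact Subtype.ext (coverPoint_eq (hmem t).1 (hΓ' t))
  locInj e := by
    refine ⟨{d | |d.1.2 - e.1.2| < 1 / 2}, ?_, ?_⟩
    · refine (isOpen_lt (by fun_prop) continuous_const).mem_nhds ?_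
      simp
    · intro d hd d' hd' h
      have h' := congrArg Subtype.val h
      obtain ⟨h1, n, hn⟩ := (coverPoint_eq_iff d.2.1 d'.2.1).1 h'
      have hd1 := abs_lt.1 (show |d.1.2 - e.1.2| < 1 / 2 from hd)
      have hd2 := abs_lt.1 (show |d'.1.2 - e.1.2| < 1 / 2 from hd')
      have h3 : (n : ℝ) < 1 := by linarith
      have h4 : (-1 : ℝ) < n := by linarith
      have h5 : n < 1 := by exact_mod_cast h3
      have h6 : -1 < n := by exact_mod_cast h4
      have h7 : n = 0 := by omega
      exact Subtype.ext (Prod.ext h1 (by rw [hn, h7]; simp))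
  localSection e := by
    classical
    let a : Compl K → ℂ := fun x => x.1.1.2 * circ (-e.1.2)
    let Y : Compl K → ℝ := fun x => e.1.2 + (a x).arg / (2 * Real.pi)
    let A : Set (Compl K) := {x | a x ∈ Complex.slitPlane}
    have ha : Continuous a := by fun_prop
    have hA : IsOpen A := Complex.isOpen_slitPlane.preimage ha
    have hY : ContinuousOn Y A := by
      intro x hx
      have h1 : ContinuousAt (fun x => (a x).arg) x :=
        ContinuousAt.comp (Complex.continuousAt_arg hx) ha.continuousAt
      exact (continuousAt_const.add (h1.div_const _)).continuousWithinAt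
    have hF : ContinuousOn (fun x : Compl K => (x.1.1.1, Y x)) A :=
      ContinuousOn.prodMk (by fun_prop) hY
    let O : Set (Compl K) := A ∩ (fun x : Compl K => (x.1.1.1, Y x)) ⁻¹' coverSet K
    have hcancel : circ e.1.2 * circ (-e.1.2) = 1 := by
      rw [← circ_add, add_neg_cancel]; simp [circ]
    refine ⟨O, fun x => if h : (x.1.1.1, Y x) ∈ coverSet K then ⟨_, h⟩ else e,
      hF.isOpen_inter_preimage hA (isOpen_coverSet hcl), ?_, ?_, ?_⟩
    · have hae : a ⟨coverPoint e.1 e.2.1, coverPoint_notMem hK e.2⟩ =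
          (Real.sqrt (1 - ‖e.1.1‖ ^ 2) : ℂ) := by
        change (Real.sqrt (1 - ‖e.1.1‖ ^ 2) : ℂ) * circ e.1.2 * circ (-e.1.2) = _
        rw [mul_assoc, hcancel, mul_one]
      have hpos := sqrt_pos_of_lt_one e.2.1
      refine ⟨?_, ?_⟩
      · change a _ ∈ Complex.slitPlane
        exact hae ▸ Complex.ofReal_mem_slitPlane.2 hpos
      · change (e.1.1, Y ⟨coverPoint e.1 e.2.1, coverPoint_notMem hK e.2⟩) ∈ coverSet K
        have : Y ⟨coverPoint e.1 e.2.1, coverPoint_notMem hK e.2⟩ = e.1.2 := by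
          change e.1.2 + (a _).arg / _ = _
          rw [hae, Complex.arg_ofReal_of_nonneg hpos.le]; simp
        rw [this]
        exact e.2
    · rw [Topology.IsInducing.subtypeVal.continuousOn_iff]
      refine (hF.mono inter_subset_left).congr fun x hx => ?_
      have : (x.1.1.1, Y x) ∈ coverSet K := hx.2
      simp only [Function.comp, dif_pos this]
    · intro x hx
      have h : (x.1.1.1, Y x) ∈ coverSet K := hx.2
      simp only [dif_pos h]
      refine Subtype.ext (coverPoint_eq h.1 ?_)
      have h1 := norm_mul_circ_arg (a x)
      have h2 : ‖a x‖ = ‖x.1.1.2‖ := by simp [a]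
      rw [h2] at h1
      change _ = _ * circ (e.1.2 + (a x).arg / (2 * Real.pi))
      rw [circ_add, mul_left_comm, h1]
      change _ = circ e.1.2 * (x.1.1.2 * circ (-e.1.2))
      rw [mul_left_comm, hcancel, mul_one]

/-- The image of a piece under a homeomorphism. -/
noncomputable def CyclicPiece.map {X Y : Type} [TopologicalSpace X] [TopologicalSpace Y]
    (P : CyclicPiece X) (h : X ≃ₜ Y) : CyclicPiece Y where
  E := P.E
  f := (h : C(X, Y)).comp P.f
  shift := P.shift
  shift_zero := P.shift_zero
  shift_add := P.shift_add
  shift_free := P.shift_free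
  f_shift n e := congrArg h (P.f_shift n e)
  exists_shift e e' he := P.exists_shift e e' (h.injective he)
  lift γ hγ e he := by
    obtain ⟨e', Γ, hΓ⟩ := P.lift (γ.map h.symm.continuous) (fun t => by
      obtain ⟨d, hd⟩ := hγ t
      exact ⟨d, (h.eq_symm_apply).2 hd⟩) e ((h.eq_symm_apply).2 he)
    exact ⟨e', Γ, fun t => (h.eq_symm_apply).1 (hΓ t)⟩
  locInj e := by
    obtain ⟨N, hN, hinj⟩ := P.locInj e
    exact ⟨N, hN, fun d hd d' hd' hdd => hinj hd hd' (h.injective hdd)⟩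
  localSection e := by
    obtain ⟨O, σ, hO, he, hσ, hs⟩ := P.localSection e
    refine ⟨h.symm ⁻¹' O, σ ∘ h.symm, hO.preimage h.symm.continuous, ?_,
      hσ.comp h.symm.continuous.continuousOn (mapsTo_preimage _ _), fun x hx => ?_⟩
    · change h.symm (h (P.f e)) ∈ O
      rwa [h.symm_apply_apply]
    · change h (P.f (σ (h.symm x))) = x
      rw [hs _ hx, h.apply_symm_apply]

/-- The interchange of the two coordinates. -/
noncomputable def swapS3 : S3 ≃ₜ S3 where
  toFun x := ⟨(x.1.2, x.1.1), by have := x.2; simp only; linarith⟩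
  invFun x := ⟨(x.1.2, x.1.1), by have := x.2; simp only; linarith⟩
  left_inv _ := rfl
  right_inv _ := rfl
  continuous_toFun := by fun_prop
  continuous_invFun := by fun_prop

/-- The homeomorphism of complements induced by a homeomorphism of the three-sphere. -/
noncomputable def complHomeomorph {K L : Set S3} (h : S3 ≃ₜ S3) (hKL : K = h ⁻¹' L) :
    Compl K ≃ₜ Compl L :=
  h.subtype fun x => by rw [hKL]; rfl

/-- A simple closed curve on the standard torus in the homology class `(p, q)`, described by a
labelling of the regions into which its preimage divides the plane: translation by a
lattice vector `(m, n)` changes the label by the intersection number `q * m - p * n`, and the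
points with a given label form one region. -/
structure IsTorusCurve (K : Set S3) (p q : ℤ) : Prop where
  isClosed : IsClosed K
  norm_eq : ∀ x ∈ K, ‖x.1.1‖ = ‖x.1.2‖
  isCoprime : IsCoprime p q
  exists_label : ∃ κ : ℝ × ℝ → ℤ,
    (∀ s : ℝ × ℝ, torusPoint s.1 s.2 ∉ K → ∀ᶠ s' in 𝓝 s, κ s' = κ s) ∧
    (∀ (s : ℝ × ℝ) (m n : ℤ), κ (s.1 + m, s.2 + n) = κ s + q * m - p * n) ∧
    IsPathConnected {s : ℝ × ℝ | torusPoint s.1 s.2 ∉ K ∧ κ s = 0}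

theorem mem_coverSet_of_torusPoint {K : Set S3} {r x y : ℝ} (hr : 0 < r) (hr1 : r < 1)
    (h : torusPoint x y ∉ K) : ((r : ℂ) * circ x, y) ∈ coverSet K := by
  have hn : ‖(r : ℂ) * circ x‖ = r := by simp [abs_of_pos hr]
  refine ⟨by simpa only [hn] using hr1, Or.inr ⟨?_, ?_⟩⟩
  · simp only
    rw [← norm_ne_zero_iff, hn]; exact hr.ne'
  · simp only
    rwa [torusPoint_congr (circ_arg_eq hr rfl) rfl]

theorem IsTorusCurve.nonempty_torusGluing {K : Set S3} {p q : ℤ} (h : IsTorusCurve K p q) :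
    Nonempty (TorusGluing (Compl K) p q) := by
  obtain ⟨hcl, hK, hco, κ, hloc, hshift, hconn⟩ := h
  let K' : Set S3 := swapS3 ⁻¹' K
  have hcl' : IsClosed K' := hcl.preimage swapS3.continuous
  have hK' : ∀ x ∈ K', ‖x.1.1‖ = ‖x.1.2‖ := fun x hx => (hK _ hx).symm
  let P := solidPiece K hcl hK
  let P' := (solidPiece K' hcl' hK').map (complHomeomorph swapS3 rfl)
  have swapPt : ∀ x y, torusPoint x y ∈ K' ↔ torusPoint y x ∈ K := fun x y => Iff.rfl
  -- Matching points lie over the same point of the torus, and off the curve.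
  have hmatch : ∀ (e : coverSet K) (e' : coverSet K'), P.f e = P'.f e' →
      ∃ r : ℝ, 0 < r ∧ r < 1 ∧ e.1.1 = r * circ e'.1.2 ∧ e'.1.1 = Real.sqrt (1 - r ^ 2) * circ e.1.2
        ∧ torusPoint e'.1.2 e.1.2 ∉ K := by
    intro e e' hee
    have h1 : e.1.1 = (Real.sqrt (1 - ‖e'.1.1‖ ^ 2) : ℂ) * circ e'.1.2 :=
      congrArg (fun x : Compl K => x.1.1.1) hee
    have h2 : (Real.sqrt (1 - ‖e.1.1‖ ^ 2) : ℂ) * circ e.1.2 = e'.1.1 :=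
      congrArg (fun x : Compl K => x.1.1.2) hee
    set r := Real.sqrt (1 - ‖e'.1.1‖ ^ 2) with hr
    have hr0 : 0 < r := sqrt_pos_of_lt_one e'.2.1
    have hs0 := sqrt_pos_of_lt_one e.2.1
    have hnr : ‖e.1.1‖ = r := by
      rw [h1, norm_mul, norm_circ, mul_one, Complex.norm_real, Real.norm_of_nonneg hr0.le]
    refine ⟨r, hr0, hnr ▸ e.2.1, h1, by rw [← h2, hnr], ?_⟩
    have c1 := circ_arg_eq hr0 h1
    have c2 := circ_arg_eq hs0 h2.symm
    rcases e.2.2 with h3 | h3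
    · rcases e'.2.2 with h4 | h4
      · have h5 : ‖e'.1.1‖ ^ 2 = 1 - ‖e.1.1‖ ^ 2 := by
          rw [← h2, norm_mul, norm_circ, mul_one, Complex.norm_real, Real.norm_of_nonneg hs0.le,
            Real.sq_sqrt (by nlinarith [norm_nonneg e.1.1, e.2.1])]
        rw [h5] at h4
        linarith
      · have := h4.2
        rw [swapPt, torusPoint_congr rfl c2] at this
        exact this
    · have := h3.2
      rw [torusPoint_congr c1 rfl] at this
      exact this
  have hpt : ∀ {r x y : ℝ}, 0 < r → r < 1 → torusPoint x y ∉ K →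
      ((r : ℂ) * circ x, y) ∈ coverSet K ∧
        ((Real.sqrt (1 - r ^ 2) : ℂ) * circ y, x) ∈ coverSet K' := by
    intro r x y hr hr1 hxy
    refine ⟨mem_coverSet_of_torusPoint hr hr1 hxy, mem_coverSet_of_torusPoint ?_ ?_ hxy⟩
    · exact Real.sqrt_pos.2 (by nlinarith)
    · rw [Real.sqrt_lt' one_pos]; nlinarith
  have hpt_match : ∀ {r x y : ℝ} (hr : 0 < r) (hr1 : r < 1) (hxy : torusPoint x y ∉ K),
      P.f (⟨_, (hpt hr hr1 hxy).1⟩ : coverSet K) =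
        P'.f (⟨_, (hpt hr hr1 hxy).2⟩ : coverSet K') := by
    intro r x y hr hr1 hxy
    have hn : ‖(r : ℂ) * circ x‖ = r := by simp [abs_of_pos hr]
    have hs : 0 ≤ 1 - r ^ 2 := by nlinarith
    have hn' : ‖(Real.sqrt (1 - r ^ 2) : ℂ) * circ y‖ = Real.sqrt (1 - r ^ 2) := by
      simp [abs_of_nonneg (Real.sqrt_nonneg _)]
    refine Subtype.ext (Subtype.ext (Prod.ext ?_ ?_))
    · change (r : ℂ) * circ x =
        (Real.sqrt (1 - ‖(Real.sqrt (1 - r ^ 2) : ℂ) * circ y‖ ^ 2) : ℂ) * circ x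
      rw [hn', Real.sq_sqrt hs, sub_sub_cancel, Real.sqrt_sq hr.le]
    · change (Real.sqrt (1 - ‖(r : ℂ) * circ x‖ ^ 2) : ℂ) * circ y = _
      rw [hn]
      rfl
  refine ⟨
    { P := P
      P' := P'
      label := fun (e : coverSet K) (e' : coverSet K') => κ (e'.1.2, e.1.2)
      isCoprime := hco
      cover := ?_
      label_eventually := ?_
      label_shift := ?_
      exists_matching := ?_
      joined := ?_ }⟩
  · rw [eq_univ_iff_forall]
    intro x
    have hsq := x.1.2
    rcases lt_or_ge ‖x.1.1.2‖ ‖x.1.1.1‖ with hlt | hge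
    · right
      have hd : (x.1.1.2, x.1.1.1.arg / (2 * Real.pi)) ∈ coverSet K' := by
        have : 2 * ‖x.1.1.2‖ ^ 2 < 1 := by nlinarith [norm_nonneg x.1.1.2]
        exact ⟨by simp only; nlinarith [norm_nonneg x.1.1.2], Or.inl this⟩
      refine ⟨(⟨_, hd⟩ : coverSet K'), Subtype.ext ?_⟩
      have := coverPoint_eq (x := swapS3.symm x.1) hd.1 (norm_mul_circ_arg _).symm
      change swapS3 (coverPoint _ hd.1) = x.1
      exact (swapS3.eq_symm_apply).1 this
    · left
      have hd : (x.1.1.1, x.1.1.2.arg / (2 * Real.pi)) ∈ coverSet K := by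
        rcases hge.eq_or_lt with heq | hlt
        · have h0 : 2 * ‖x.1.1.1‖ ^ 2 = 1 := by rw [← heq] at hsq; linarith
          refine ⟨by simp only; nlinarith [norm_nonneg x.1.1.1], Or.inr ⟨?_, ?_⟩⟩
          · intro hz
            simp only at hz
            rw [hz] at h0
            norm_num at h0
          · simp only
            rw [torusPoint_arg heq (norm_mul_circ_arg _).symm]
            exact x.2
        · have : 2 * ‖x.1.1.1‖ ^ 2 < 1 := by nlinarith [norm_nonneg x.1.1.1]
          exact ⟨by simp only; nlinarith [norm_nonneg x.1.1.1], Or.inl this⟩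
      exact ⟨(⟨_, hd⟩ : coverSet K), Subtype.ext (coverPoint_eq hd.1 (norm_mul_circ_arg _).symm)⟩
  · intro e e' hee
    obtain ⟨r, -, -, -, -, hoff⟩ := hmatch e e' hee
    have hcont : Continuous fun w : coverSet K × coverSet K' => (w.2.1.2, w.1.1.2) := by fun_prop
    filter_upwards [(hcont.tendsto (e, e')).eventually (hloc (e'.1.2, e.1.2) hoff)] with w hw _
    exact hw
  · intro e e' n m _
    exact hshift (e'.1.2, e.1.2) m n
  · obtain ⟨s, hs, -⟩ := hconn
    exact ⟨_, _, hpt_match one_half_pos one_half_lt_one hs.1, hs.2⟩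
  · intro e₁ e₁' e₂ e₂' h1 h2 hl1 hl2
    obtain ⟨r₁, ha0, ha1, hz1, hw1, hoff1⟩ := hmatch e₁ e₁' h1
    obtain ⟨r₂, hb0, hb1, hz2, hw2, hoff2⟩ := hmatch e₂ e₂' h2
    obtain ⟨γ, hγ⟩ := hconn.joinedIn (e₁'.1.2, e₁.1.2) ⟨hoff1, hl1⟩ (e₂'.1.2, e₂.1.2) ⟨hoff2, hl2⟩
    let r : unitInterval → ℝ := fun t => (1 - t) * r₁ + t * r₂
    have hr : ∀ t, 0 < r t ∧ r t < 1 := by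
      intro t
      have h0 := t.2.1
      have h1 := t.2.2
      constructor
      · simp only [r]
        rcases h0.eq_or_lt with h | h
        · rw [← h]; simpa using ha0
        · nlinarith [mul_pos h hb0, mul_nonneg (sub_nonneg.2 h1) ha0.le]
      · simp only [r]
        rcases h0.eq_or_lt with h | h
        · rw [← h]; simpa using ha1
        · nlinarith [mul_pos h (sub_pos.2 hb1), mul_nonneg (sub_nonneg.2 h1) (sub_pos.2 ha1).le]
    have hrc : Continuous r := by fun_prop
    refine ⟨⟨⟨fun t => (⟨_, (hpt (hr t).1 (hr t).2 (hγ t).1).1⟩ : coverSet K), ?_⟩, ?_, ?_⟩,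
      ⟨⟨fun t => (⟨_, (hpt (hr t).1 (hr t).2 (hγ t).1).2⟩ : coverSet K'), ?_⟩, ?_, ?_⟩,
      fun t => hpt_match (hr t).1 (hr t).2 (hγ t).1⟩
    · refine Continuous.subtype_mk ?_ _
      fun_prop
    · refine Subtype.ext (Prod.ext ?_ ?_)
      · simp [r, hz1]
      · simp
    · refine Subtype.ext (Prod.ext ?_ ?_)
      · simp [r, hz2]
      · simp
    · refine Continuous.subtype_mk ?_ _
      fun_prop
    · refine Subtype.ext (Prod.ext ?_ ?_)
      · simp [r, hw1]
      · simp
    · refine Subtype.ext (Prod.ext ?_ ?_)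
      · simp [r, hw2]
      · simp

/-! ### The classification of curves on the torus -/

theorem TorusGluing.pathConnectedSpace {X : Type} [TopologicalSpace X] {p q : ℤ}
    (D : TorusGluing X p q) : PathConnectedSpace X := by
  rw [pathConnectedSpace_iff_univ, ← D.cover]
  obtain ⟨e, e', h, -⟩ := D.exists_matching
  exact (isPathConnected_range D.P.f.continuous).union (isPathConnected_range D.P'.f.continuous)
    ⟨D.P.f e, ⟨e, rfl⟩, ⟨e', h.symm⟩⟩

theorem fundamentalGroup_map_bijective {X Y : Type} [TopologicalSpace X] [TopologicalSpace Y]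
    (h : X ≃ₜ Y) (x : X) : Function.Bijective (FundamentalGroup.map (h : C(X, Y)) x) := by
  constructor
  · intro a b hab
    obtain ⟨γ, rfl⟩ := Path.Homotopic.Quotient.mk_surjective a
    obtain ⟨δ, rfl⟩ := Path.Homotopic.Quotient.mk_surjective b
    have h1 : (γ.map h.continuous).Homotopic (δ.map h.continuous) :=
      Path.Homotopic.Quotient.exact hab
    have h2 := (h1.map (h.symm : C(Y, X))).pathCast (h.symm_apply_apply x).symm
      (h.symm_apply_apply x).symm
    refine Path.Homotopic.Quotient.eq.2 ?_
    convert! h2 using 1 <;> · ext t; simp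
  · intro a
    obtain ⟨γ, rfl⟩ := Path.Homotopic.Quotient.mk_surjective a
    refine ⟨Path.Homotopic.Quotient.mk ((γ.map h.symm.continuous).cast
      (h.symm_apply_apply x).symm (h.symm_apply_apply x).symm), ?_⟩
    refine congrArg Path.Homotopic.Quotient.mk ?_
    ext t
    exact h.apply_symm_apply _

/-- The classification of curves on the standard torus up to homeomorphisms of the three-sphere:
the homology class can be read off, up to signs and the interchange of the coordinates, unless the
curve is unknotted. -/
theorem IsTorusCurve.natAbs_eq {K L : Set S3} {p q p' q' : ℤ} (hK : IsTorusCurve K p q)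
    (hL : IsTorusCurve L p' q') (h : S3 ≃ₜ S3) (hKL : h '' K = L) :
    ((p'.natAbs = 1 ∨ q'.natAbs = 1) ∧ (p.natAbs = 1 ∨ q.natAbs = 1)) ∨
      (p.natAbs = p'.natAbs ∧ q.natAbs = q'.natAbs) ∨
      (p.natAbs = q'.natAbs ∧ q.natAbs = p'.natAbs) := by
  obtain ⟨D⟩ := hK.nonempty_torusGluing
  obtain ⟨D'⟩ := hL.nonempty_torusGluing
  have := D'.pathConnectedSpace
  obtain ⟨x, hx⟩ := D.isTorusGroup
  obtain ⟨y, hy⟩ := D'.isTorusGroup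
  let φ := complHomeomorph (K := K) (L := L) h (by rw [← hKL, h.preimage_image])
  exact hx.natAbs_eq hy ((MulEquiv.ofBijective _ (fundamentalGroup_map_bijective φ x)).trans
    (FundamentalGroup.fundamentalGroupMulEquivOfPathConnected (φ x) y)) hK.isCoprime hL.isCoprime

theorem torusPoint_norm_eq (x y : ℝ) : ‖(torusPoint x y).1.1‖ = ‖(torusPoint x y).1.2‖ := by
  rw [torusPoint_val]
  simp

theorem torusKnot_eq_image (p q : ℕ) :
    torusKnot p q = (fun t : ℝ => torusPoint (t * p) (t * q)) '' Icc 0 1 := by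
  refine Subset.antisymm ?_ (image_subset_range _ _)
  rintro _ ⟨t, rfl⟩
  refine ⟨Int.fract t, ⟨Int.fract_nonneg t, (Int.fract_lt_one t).le⟩, ?_⟩
  refine torusPoint_eq_iff.2 ⟨⟨-⌊t⌋ * p, ?_⟩, ⟨-⌊t⌋ * q, ?_⟩⟩ <;>
  · rw [Int.fract]; push_cast; ring

theorem isClosed_torusKnot (p q : ℕ) : IsClosed (torusKnot p q) := by
  rw [torusKnot_eq_image]
  exact (isCompact_Icc.image (by fun_prop)).isClosed

theorem torusPoint_mem_torusKnot {p q : ℕ} (hpq : p.Coprime q) {x y : ℝ} :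
    torusPoint x y ∈ torusKnot p q ↔ ∃ k : ℤ, q * x - p * y = k := by
  constructor
  · rintro ⟨t, ht⟩
    obtain ⟨⟨m, hm⟩, ⟨n, hn⟩⟩ := torusPoint_eq_iff.1 ht.symm
    exact ⟨q * m - p * n, by rw [hm, hn]; push_cast; ring⟩
  · rintro ⟨k, hk⟩
    have hc := (Nat.isCoprime_iff_coprime.2 hpq)
    obtain ⟨u, v, huv⟩ := hc
    have huv' : (u * p + v * q : ℝ) = 1 := by exact_mod_cast huv
    refine ⟨u * x + v * y, torusPoint_eq_iff.2 ⟨⟨-(v * k), ?_⟩, ⟨u * k, ?_⟩⟩⟩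
    · push_cast
      linear_combination (-v) * hk + x * huv'
    · push_cast
      linear_combination u * hk + y * huv'

theorem eventually_floor_eq {X : Type*} [TopologicalSpace X] {f : X → ℝ} {s : X}
    (hf : ContinuousAt f s) (h : ∀ k : ℤ, f s ≠ k) : ∀ᶠ s' in 𝓝 s, ⌊f s'⌋ = ⌊f s⌋ := by
  have hlt : (⌊f s⌋ : ℝ) < f s := lt_of_le_of_ne (Int.floor_le _) (h _).symm
  filter_upwards [hf.eventually (lt_mem_nhds hlt),
    hf.eventually (gt_mem_nhds (Int.lt_floor_add_one (f s)))] with s' h1 h2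
  exact Int.floor_eq_iff.2 ⟨le_of_lt h1, h2⟩

theorem isTorusCurve_torusKnot {p q : ℕ} (hpq : p.Coprime q) :
    IsTorusCurve (torusKnot p q) p q where
  isClosed := isClosed_torusKnot p q
  norm_eq := by
    rintro _ ⟨t, rfl⟩
    exact torusPoint_norm_eq _ _
  isCoprime := Nat.isCoprime_iff_coprime.2 hpq
  exists_label := by
    refine ⟨fun s => ⌊q * s.1 - p * s.2⌋, fun s hs => ?_, fun s m n => ?_, ?_⟩
    · rw [torusPoint_mem_torusKnot hpq] at hs
      exact eventually_floor_eq (f := fun s : ℝ × ℝ => (q * s.1 - p * s.2 : ℝ)) (by fun_prop)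
        fun k hk => hs ⟨k, hk⟩
    · have : (q * (s.1 + m) - p * (s.2 + n) : ℝ) =
          q * s.1 - p * s.2 + ((q * m - p * n : ℤ) : ℝ) := by push_cast; ring
      simp only
      rw [this, Int.floor_add_intCast]
      ring
    · have hset : {s : ℝ × ℝ | torusPoint s.1 s.2 ∉ torusKnot p q ∧ ⌊q * s.1 - p * s.2⌋ = 0} =
          {s : ℝ × ℝ | 0 < q * s.1 - p * s.2} ∩ {s | q * s.1 - p * s.2 < 1} := by
        ext s
        simp only [mem_ofPred_eq, mem_inter_iff, torusPoint_mem_torusKnot hpq, Int.floor_eq_iff,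
          Int.cast_zero, zero_add]
        constructor
        · rintro ⟨h1, h2, h3⟩
          exact ⟨lt_of_le_of_ne h2 fun h => h1 ⟨0, by rw [← h]; simp⟩, h3⟩
        · rintro ⟨h1, h2⟩
          refine ⟨?_, h1.le, h2⟩
          rintro ⟨k, hk⟩
          rw [hk] at h1 h2
          have h1' : 0 < k := by exact_mod_cast h1
          have h2' : k < 1 := by exact_mod_cast h2
          omega
      rw [hset]
      have hlin : IsLinearMap ℝ fun s : ℝ × ℝ => (q * s.1 - p * s.2 : ℝ) :=
        ⟨fun a b => by simp; ring, fun c a => by simp; ring⟩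
      refine Convex.isPathConnected
        ((convex_halfSpace_gt hlin 0).inter (convex_halfSpace_lt hlin 1)) ?_
      obtain ⟨u, v, huv⟩ := Nat.isCoprime_iff_coprime.2 hpq
      have huv' : (u * p + v * q : ℝ) = 1 := by exact_mod_cast huv
      refine ⟨(v / 2, -u / 2), ?_, ?_⟩
      · change (0 : ℝ) < q * (v / 2) - p * (-u / 2)
        linarith
      · change q * (v / 2) - p * (-u / 2) < (1 : ℝ)
        linarith

/-! ### The regions of the torus after surgery along a band -/

/-- The point of the torus with the coordinates `τ`, the time along `T(p,q)`, and `u`, the number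
of strands crossed in the direction of the first coordinate. -/
noncomputable def strandPoint (p q : ℕ) (τ u : ℝ) : S3 := torusPoint (τ * p + u / q) (τ * q)

/-- The numerical data of a pinch move: `J / q` is the time shift between adjacent strands, and the
band is shorter than the arcs into which the times `0` and `J / q` divide the period. -/
structure IsPinchData (p q : ℕ) (t J : ℤ) (d : ℝ) : Prop where
  q_pos : 0 < q
  bezout : J * p = t * q + 1
  d_pos : 0 < d
  d_lt : d < J / q
  d_lt' : d < 1 - J / q

/-- The label of the regions of the torus after the surgery. In the strip between the strands `i`
and `i + 1` the sides of the bands are at the times at which `τ + i * J / q - c` or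
`τ + i * J / q - c - d` is an integer. -/
noncomputable def pinchLabel (q : ℕ) (J : ℤ) (c d τ u : ℝ) : ℤ :=
  ⌊τ + ⌊u⌋ * (J / q) - c⌋ + ⌊τ + ⌊u⌋ * (J / q) - c - d⌋ + 1 - ⌊u⌋

/-- The deck transformations of the torus in these coordinates: the strand `k` over, at the same
point, is reached at a time that is `k * J / q` earlier. -/
theorem strandPoint_eq_iff {p q : ℕ} {t J : ℤ} (hq : 0 < q) (h : J * p = t * q + 1)
    {τ u τ' u' : ℝ} : strandPoint p q τ u = strandPoint p q τ' u' ↔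
      ∃ n k : ℤ, τ = τ' + n - k * (J / q) ∧ u = u' + k := by
  have hq' : (q : ℝ) ≠ 0 := by exact_mod_cast hq.ne'
  have hr : (J * p : ℝ) = t * q + 1 := by exact_mod_cast h
  rw [strandPoint, strandPoint, torusPoint_eq_iff]
  constructor
  · rintro ⟨⟨M, hM⟩, ⟨N, hN⟩⟩
    refine ⟨M * J - t * N, q * M - p * N, ?_, ?_⟩
    · push_cast
      field_simp
      linear_combination hN - N * hr
    · push_cast
      field_simp at hM
      linear_combination hM - p * hN
  · rintro ⟨n, k, h1, h2⟩
    refine ⟨⟨n * p - k * t, ?_⟩, ⟨n * q - k * J, ?_⟩⟩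
    · rw [h1, h2]
      push_cast
      field_simp
      linear_combination -k * hr
    · rw [h1]
      push_cast
      field_simp
      ring

theorem strandPoint_mem_torusKnot {p q : ℕ} (hq : 0 < q) (hpq : p.Coprime q) {τ u : ℝ} :
    strandPoint p q τ u ∈ torusKnot p q ↔ ∃ k : ℤ, u = k := by
  have hq' : (q : ℝ) ≠ 0 := by exact_mod_cast hq.ne'
  rw [strandPoint, torusPoint_mem_torusKnot hpq]
  have : q * (τ * p + u / q) - p * (τ * q) = u := by field_simp; ring
  rw [this]

/-- The embeddedness of the band bounds its length. -/
theorem IsPinchData.of_isBand {p q : ℕ} {t J : ℤ} {c d : ℝ} (hq : 0 < q)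
    (h : J * p = t * q + 1) (hJ0 : 0 ≤ J) (hJq : J < q) (hd : 0 < d)
    (hb : IsBand (torusKnot p q) (straightBand p q c d)) : IsPinchData p q t J d := by
  have hq' : (0 : ℝ) < q := by exact_mod_cast hq
  have hθ0 : (0 : ℝ) ≤ J / q := div_nonneg (by exact_mod_cast hJ0) hq'.le
  have hθ1 : (J / q : ℝ) < 1 := by rw [div_lt_one hq']; exact_mod_cast hJq
  refine ⟨hq, h, hd, ?_, ?_⟩
  · by_contra hcon
    push Not at hcon
    have hm : ((J / q / d : ℝ), (0 : ℝ)) ∈ Icc (0 : ℝ) 1 ×ˢ Icc (0 : ℝ) 1 :=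
      ⟨⟨by positivity, (div_le_one hd).2 hcon⟩, by simp⟩
    have hm' : ((0 : ℝ), (1 : ℝ)) ∈ Icc (0 : ℝ) 1 ×ˢ Icc (0 : ℝ) 1 := by simp
    have := hb.injOn hm hm' ((strandPoint_eq_iff hq h).2 ⟨0, -1, by
      simp only [Int.cast_zero, Int.cast_neg, Int.cast_one]; field_simp; ring, by simp⟩)
    have h2 := congrArg Prod.snd this
    norm_num at h2
  · by_contra hcon
    push Not at hcon
    have hm : (((1 - J / q) / d : ℝ), (1 : ℝ)) ∈ Icc (0 : ℝ) 1 ×ˢ Icc (0 : ℝ) 1 :=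
      ⟨⟨div_nonneg (by linarith) hd.le, (div_le_one hd).2 hcon⟩, by simp⟩
    have hm' : ((0 : ℝ), (0 : ℝ)) ∈ Icc (0 : ℝ) 1 ×ˢ Icc (0 : ℝ) 1 := by simp
    have := hb.injOn hm hm' ((strandPoint_eq_iff hq h).2 ⟨1, 1, by
      simp only [Int.cast_one]; field_simp; ring, by simp⟩)
    have h2 := congrArg Prod.snd this
    norm_num at h2

namespace IsPinchData

variable {p q : ℕ} {t J : ℤ} {c d : ℝ}

/-- On a strand, the two arcs that are removed begin at the relative times `0` and `J / q`. -/
theorem mem_arcs_iff (h : IsPinchData p q t J d) {τ u : ℝ} :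
    strandPoint p q τ u ∈ straightBand p q c d '' (Ioo 0 1 ×ˢ {0, 1}) ↔
      (∃ i : ℤ, u = i) ∧ ∃ n : ℤ,
        (τ + ⌊u⌋ * (J / q) - c ∈ Ioo (n : ℝ) (n + d) ∨
          τ + ⌊u⌋ * (J / q) - c ∈ Ioo (n + J / q : ℝ) (n + J / q + d)) := by
  have hd := h.d_pos
  constructor
  · rintro ⟨⟨s, x⟩, ⟨hs, hx⟩, hsx⟩
    obtain ⟨n, k, h1, h2⟩ := (strandPoint_eq_iff h.q_pos h.bezout).1 hsx.symm
    simp only at h1 h2 hs hx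
    have hs0 : 0 < d * s := mul_pos hd hs.1
    have hs1 : d * s < d := by nlinarith [hs.2]
    rcases hx with hx | hx
    · have hu : u = k := by rw [h2, hx, zero_add]
      refine ⟨⟨k, hu⟩, n, Or.inl ?_⟩
      rw [hu, Int.floor_intCast, h1]
      constructor <;> linarith
    · have hx' : x = 1 := hx
      have hu : u = (k + 1 : ℤ) := by rw [h2, hx']; push_cast; ring
      refine ⟨⟨k + 1, hu⟩, n, Or.inr ?_⟩
      rw [hu, Int.floor_intCast, h1]
      push_cast
      constructor <;> linarith
  · rintro ⟨⟨i, rfl⟩, n, hn⟩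
    rw [Int.floor_intCast] at hn
    have key : ∀ e : ℝ, 0 < e → e < d → e / d ∈ Ioo (0 : ℝ) 1 := fun e h0 h1 =>
      ⟨div_pos h0 hd, (div_lt_one hd).2 h1⟩
    rcases hn with ⟨h1, h2⟩ | ⟨h1, h2⟩
    · refine ⟨(_, 0), ⟨key (τ + i * (J / q) - c - n) (by linarith) (by linarith), by simp⟩, ?_⟩
      refine ((strandPoint_eq_iff h.q_pos h.bezout).2 ⟨n, i, ?_, by simp⟩).symm
      simp only
      field_simp
      ring
    · refine ⟨(_, 1), ⟨key (τ + i * (J / q) - c - n - J / q) (by linarith) (by linarith), by simp⟩,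
        ?_⟩
      refine ((strandPoint_eq_iff h.q_pos h.bezout).2 ⟨n, i - 1, ?_, by simp⟩).symm
      simp only
      field_simp
      push_cast
      ring

/-- Between the strands `k` and `k + 1`, the sides of the bands that cross are at the relative times
`0` and `d`. -/
theorem mem_sides_iff (h : IsPinchData p q t J d) {τ u : ℝ} :
    strandPoint p q τ u ∈ straightBand p q c d '' ({0, 1} ×ˢ Icc 0 1) ↔
      ∃ n k : ℤ, (τ + k * (J / q) - c = n ∨ τ + k * (J / q) - c = n + d) ∧
        u - k ∈ Icc (0 : ℝ) 1 := by
  constructor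
  · rintro ⟨⟨s, x⟩, ⟨hs, hx⟩, hsx⟩
    obtain ⟨n, k, h1, h2⟩ := (strandPoint_eq_iff h.q_pos h.bezout).1 hsx.symm
    simp only at h1 h2 hs hx
    refine ⟨n, k, ?_, by rw [h2, add_sub_cancel_right]; exact hx⟩
    rcases hs with hs | hs
    · left
      rw [h1, hs]; ring
    · right
      rw [h1, show s = 1 from hs]; ring
  · rintro ⟨n, k, hn | hn, hu⟩
    · refine ⟨(0, u - k), ⟨by simp, hu⟩, ?_⟩
      refine ((strandPoint_eq_iff h.q_pos h.bezout).2 ⟨n, k, ?_, by simp⟩).symm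
      linear_combination hn
    · refine ⟨(1, u - k), ⟨by simp, hu⟩, ?_⟩
      refine ((strandPoint_eq_iff h.q_pos h.bezout).2 ⟨n, k, ?_, by simp⟩).symm
      linear_combination hn

/-- Between the strands, the points outside of the new curve are those that are not on a side of
a band. -/
theorem notMem_surgery_of_strip (h : IsPinchData p q t J d) (hpq : p.Coprime q) {τ u : ℝ} {i : ℤ}
    (hu0 : i < u) (hu1 : u < i + 1) :
    strandPoint p q τ u ∉ surgery (torusKnot p q) (straightBand p q c d) ↔
      ∀ n : ℤ, τ + i * (J / q) - c ≠ n ∧ τ + i * (J / q) - c ≠ n + d := by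
  have hnot : ¬ ∃ k : ℤ, u = k := by
    rintro ⟨k, rfl⟩
    have h1 : i < k := by exact_mod_cast hu0
    have h2 : k < i + 1 := by exact_mod_cast hu1
    omega
  rw [surgery, mem_union, not_or, Set.mem_sdiff, strandPoint_mem_torusKnot h.q_pos hpq,
    h.mem_sides_iff]
  simp only [hnot, false_and, not_false_iff, true_and]
  constructor
  · intro hn n
    constructor
    · exact fun hc => hn ⟨n, i, Or.inl hc, by constructor <;> linarith⟩
    · exact fun hc => hn ⟨n, i, Or.inr hc, by constructor <;> linarith⟩
  · rintro hn ⟨n, k, hk, hu⟩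
    have hki : k = i := by
      have h1 : (k : ℝ) < i + 1 := by linarith [hu.1]
      have h2 : (i : ℝ) < k + 1 := by linarith [hu.2]
      have h1' : k < i + 1 := by exact_mod_cast h1
      have h2' : i < k + 1 := by exact_mod_cast h2
      omega
    subst hki
    exact hk.elim (hn n).1 (hn n).2

/-- On a strand, the points outside of the new curve are those of the removed arcs. -/
theorem notMem_surgery_of_strand (h : IsPinchData p q t J d) (hpq : p.Coprime q) {τ : ℝ} {i : ℤ} :
    strandPoint p q τ i ∉ surgery (torusKnot p q) (straightBand p q c d) ↔
      ∃ n : ℤ, τ + i * (J / q) - c ∈ Ioo (n : ℝ) (n + d) ∨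
          τ + i * (J / q) - c ∈ Ioo (n + J / q : ℝ) (n + J / q + d) := by
  have hd := h.d_pos
  have hd1 := h.d_lt
  have hd2 := h.d_lt'
  rw [surgery, mem_union, not_or, Set.mem_sdiff, strandPoint_mem_torusKnot h.q_pos hpq,
    h.mem_arcs_iff, h.mem_sides_iff, Int.floor_intCast]
  simp only [Int.cast_inj, exists_eq', true_and, not_not]
  refine ⟨fun hn => hn.1, fun hn => ⟨hn, ?_⟩⟩
  rintro ⟨n', k, hk, hu⟩
  obtain ⟨n, hn⟩ := hn
  set φ := τ + i * (J / q : ℝ) - c with hφ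
  set θ : ℝ := J / q with hθ
  have hk01 : k = i ∨ k = i - 1 := by
    have h1 : (k : ℝ) ≤ i := by linarith [hu.1]
    have h2 : (i : ℝ) ≤ k + 1 := by linarith [hu.2]
    have h1' : k ≤ i := by exact_mod_cast h1
    have h2' : i ≤ k + 1 := by exact_mod_cast h2
    omega
  -- The endpoints of the two arcs are outside of the open arcs.
  have hends : φ = n' ∨ φ = n' + d ∨ φ = n' + θ ∨ φ = n' + θ + d := by
    rcases hk01 with rfl | rfl
    · rcases hk with hk | hk
      · exact Or.inl hk
      · exact Or.inr (Or.inl hk)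
    · push_cast at hk
      rcases hk with hk | hk
      · exact Or.inr (Or.inr (Or.inl (by rw [hφ]; linarith)))
      · exact Or.inr (Or.inr (Or.inr (by rw [hφ]; linarith)))
  have h3 : (n' : ℝ) < n + 1 := by
    rcases hn with hn | hn <;> rcases hends with e | e | e | e <;> linarith [hn.2]
  have h4 : (n : ℝ) < n' + 1 := by
    rcases hn with hn | hn <;> rcases hends with e | e | e | e <;> linarith [hn.1]
  have h3' : n' < n + 1 := by exact_mod_cast h3
  have h4' : n < n' + 1 := by exact_mod_cast h4
  have h5 : n' = n := by omega
  subst h5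
  rcases hn with hn | hn <;> rcases hends with e | e | e | e <;> linarith [hn.1, hn.2]

/-- The label is the same on both sides of a removed arc. -/
theorem pinchLabel_near_arc (h : IsPinchData p q t J d) {τ u : ℝ} {i n : ℤ} (hu0 : i - 1 < u)
    (hu1 : u < i + 1) :
    (τ + i * (J / q) - c ∈ Ioo (n : ℝ) (n + d) → pinchLabel q J c d τ u = 2 * n - i) ∧
    (τ + i * (J / q) - c ∈ Ioo (n + J / q : ℝ) (n + J / q + d) →
      pinchLabel q J c d τ u = 2 * n + 1 - i) := by
  have hd := h.d_pos
  have hd1 := h.d_lt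
  have hd2 := h.d_lt'
  rw [pinchLabel]
  have hfl : ⌊u⌋ = i ∨ ⌊u⌋ = i - 1 := by
    rcases lt_or_ge u i with hlt | hge
    · right
      rw [Int.floor_eq_iff]; push_cast
      constructor <;> linarith
    · left
      exact Int.floor_eq_iff.2 ⟨hge, hu1⟩
  have hfloor : ∀ (x : ℝ) (m : ℤ), (m : ℝ) ≤ x → x < m + 1 → ⌊x⌋ = m := fun x m h1 h2 =>
    Int.floor_eq_iff.2 ⟨h1, h2⟩
  set θ : ℝ := J / q with hθ
  constructor
  · rintro ⟨h1, h2⟩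
    rcases hfl with hfl | hfl
    · rw [hfl, hfloor _ n (by linarith) (by linarith),
        hfloor _ (n - 1) (by push_cast; linarith) (by push_cast; linarith)]
      ring
    · rw [hfl, hfloor _ (n - 1) (by push_cast; linarith) (by push_cast; linarith),
        hfloor _ (n - 1) (by push_cast; linarith) (by push_cast; linarith)]
      ring
  · rintro ⟨h1, h2⟩
    rcases hfl with hfl | hfl
    · rw [hfl, hfloor _ n (by linarith) (by linarith), hfloor _ n (by linarith) (by linarith)]
      ring
    · rw [hfl, hfloor _ n (by push_cast; linarith) (by push_cast; linarith),
        hfloor _ (n - 1) (by push_cast; linarith) (by push_cast; linarith)]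
      ring

/-- The label is locally constant off the new curve. -/
theorem pinchLabel_eventually (h : IsPinchData p q t J d) (hpq : p.Coprime q) {s : ℝ × ℝ}
    (hs : strandPoint p q s.1 s.2 ∉ surgery (torusKnot p q) (straightBand p q c d)) :
    ∀ᶠ s' in 𝓝 s, pinchLabel q J c d s'.1 s'.2 = pinchLabel q J c d s.1 s.2 := by
  have hu : ContinuousAt (fun s : ℝ × ℝ => s.2) s := by fun_prop
  rcases (Int.floor_le s.2).eq_or_lt with hi | hi
  · set i := ⌊s.2⌋
    rw [← hi, h.notMem_surgery_of_strand hpq] at hs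
    have h1 := hu.eventually (lt_mem_nhds (show (i : ℝ) - 1 < s.2 by linarith))
    have h2 := hu.eventually (gt_mem_nhds (show s.2 < (i : ℝ) + 1 by linarith))
    have hφ : ContinuousAt (fun s : ℝ × ℝ => s.1 + i * (J / q : ℝ) - c) s := by fun_prop
    obtain ⟨n, hn | hn⟩ := hs
    · filter_upwards [h1, h2, hφ.eventually (isOpen_Ioo.mem_nhds hn)] with s' h3 h4 h5
      rw [(h.pinchLabel_near_arc h3 h4).1 h5,
        (h.pinchLabel_near_arc (u := s.2) (by linarith) (by linarith)).1 hn]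
    · filter_upwards [h1, h2, hφ.eventually (isOpen_Ioo.mem_nhds hn)] with s' h3 h4 h5
      rw [(h.pinchLabel_near_arc h3 h4).2 h5,
        (h.pinchLabel_near_arc (u := s.2) (by linarith) (by linarith)).2 hn]
  · have hoff := (h.notMem_surgery_of_strip hpq hi (Int.lt_floor_add_one _)).1 hs
    have h1 := eventually_floor_eq hu fun k hk => by
      rw [hk, Int.floor_intCast] at hi
      exact hi.false
    have h2 := eventually_floor_eq (s := s) (f := fun s' : ℝ × ℝ => s'.1 + ⌊s.2⌋ * (J / q : ℝ) - c)
      (by fun_prop) fun k => (hoff k).1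
    have h3 := eventually_floor_eq (s := s)
      (f := fun s' : ℝ × ℝ => s'.1 + ⌊s.2⌋ * (J / q : ℝ) - c - d) (by fun_prop)
      fun k hk => (hoff k).2 (by linarith)
    filter_upwards [h1, h2, h3] with s' e1 e2 e3
    rw [pinchLabel, pinchLabel, e1, e2, e3]

/-- The part of the region with label zero between the strands `i` and `i + 1` is bounded by sides
of bands, and it meets the two strands in removed arcs. -/
theorem exists_strip (h : IsPinchData p q t J d) (hpq : p.Coprime q) (c : ℝ) (i : ℤ) :
    ∃ lo hi a b : ℝ, lo ≤ a ∧ a + d ≤ hi ∧ lo ≤ b ∧ b + d ≤ hi ∧ ∀ τ u : ℝ,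
      (i < u → u < i + 1 → ((strandPoint p q τ u ∉ surgery (torusKnot p q) (straightBand p q c d) ∧
        pinchLabel q J c d τ u = 0) ↔ τ ∈ Ioo lo hi)) ∧
      (u = i → ((strandPoint p q τ u ∉ surgery (torusKnot p q) (straightBand p q c d) ∧
        pinchLabel q J c d τ u = 0) ↔ τ ∈ Ioo a (a + d))) ∧
      (u = i + 1 → ((strandPoint p q τ u ∉ surgery (torusKnot p q) (straightBand p q c d) ∧
        pinchLabel q J c d τ u = 0) ↔ τ ∈ Ioo b (b + d))) := by
  have hd := h.d_pos
  have hd1 := h.d_lt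
  have hd2 := h.d_lt'
  have hline : ∀ (j m : ℤ) (τ u : ℝ), u = j →
      (j = 2 * m → ((strandPoint p q τ u ∉ surgery (torusKnot p q) (straightBand p q c d) ∧
        pinchLabel q J c d τ u = 0) ↔ τ + j * (J / q) - c ∈ Ioo (m : ℝ) (m + d))) ∧
      (j = 2 * m + 1 → ((strandPoint p q τ u ∉ surgery (torusKnot p q) (straightBand p q c d) ∧
        pinchLabel q J c d τ u = 0) ↔
          τ + j * (J / q) - c ∈ Ioo (m + J / q : ℝ) (m + J / q + d))) := by
    rintro j m τ u rfl
    rw [h.notMem_surgery_of_strand hpq]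
    have hlab : ∀ n : ℤ, _ := fun n => h.pinchLabel_near_arc (c := c) (τ := τ) (u := j) (i := j)
      (n := n) (by linarith) (by linarith)
    refine ⟨fun hj => ⟨?_, fun hm => ⟨⟨m, Or.inl hm⟩, ?_⟩⟩,
      fun hj => ⟨?_, fun hm => ⟨⟨m, Or.inr hm⟩, ?_⟩⟩⟩
    · rintro ⟨⟨n, hn | hn⟩, h0⟩
      · rw [(hlab n).1 hn] at h0
        have : n = m := by omega
        rwa [this] at hn
      · rw [(hlab n).2 hn] at h0
        omega
    · rw [(hlab m).1 hm]; omega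
    · rintro ⟨⟨n, hn | hn⟩, h0⟩
      · rw [(hlab n).1 hn] at h0
        omega
      · rw [(hlab n).2 hn] at h0
        have : n = m := by omega
        rwa [this] at hn
    · rw [(hlab m).2 hm]; omega
  have hstrip : ∀ (m : ℤ) (τ u : ℝ), i < u → u < i + 1 →
      (i = 2 * m → ((strandPoint p q τ u ∉ surgery (torusKnot p q) (straightBand p q c d) ∧
        pinchLabel q J c d τ u = 0) ↔ τ + i * (J / q) - c ∈ Ioo (m : ℝ) (m + d))) ∧
      (i = 2 * m + 1 → ((strandPoint p q τ u ∉ surgery (torusKnot p q) (straightBand p q c d) ∧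
        pinchLabel q J c d τ u = 0) ↔ τ + i * (J / q) - c ∈ Ioo (m + d : ℝ) (m + 1))) := by
    intro m τ u hu0 hu1
    rw [h.notMem_surgery_of_strip hpq hu0 hu1, pinchLabel,
      show ⌊u⌋ = i from Int.floor_eq_iff.2 ⟨hu0.le, hu1⟩]
    set φ := τ + i * (J / q : ℝ) - c with hφ
    have hfl := Int.floor_le φ
    have hfl1 := Int.lt_floor_add_one φ
    set n := ⌊φ⌋ with hn
    have hfloor : ∀ (m : ℤ), (m : ℝ) ≤ φ - d → φ - d < m + 1 → ⌊φ - d⌋ = m := fun m h1 h2 =>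
      Int.floor_eq_iff.2 ⟨h1, h2⟩
    have hsub : ∀ k : ℤ, (k : ℝ) < φ → φ < k + 1 → ∀ m : ℤ, φ ≠ m := by
      intro k h1 h2 m hm
      rw [hm] at h1 h2
      have h1' : k < m := by exact_mod_cast h1
      have h2' : m < k + 1 := by exact_mod_cast h2
      omega
    have hsub' : ∀ k : ℤ, (k : ℝ) < φ - d → φ - d < k + 1 → ∀ m : ℤ, φ ≠ m + d := by
      intro k h1 h2 m hm
      rw [hm, add_sub_cancel_right] at h1 h2
      have h1' : k < m := by exact_mod_cast h1
      have h2' : m < k + 1 := by exact_mod_cast h2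
      omega
    have hne : ∀ k : ℤ, (k : ℝ) ≤ φ → φ < k + 1 → n = k := fun k h1 h2 =>
      Int.floor_eq_iff.2 ⟨h1, h2⟩
    refine ⟨fun hi => ⟨?_, fun hm => ?_⟩, fun hi => ⟨?_, fun hm => ?_⟩⟩
    · rintro ⟨hoff, h0⟩
      rcases lt_or_ge (φ - d) n with hlt | hge
      · rw [hfloor (n - 1) (by push_cast; linarith) (by push_cast; linarith)] at h0
        have hnm : n = m := by omega
        have := (hoff n).1
        rw [← hnm]
        exact ⟨lt_of_le_of_ne hfl this.symm, by linarith⟩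
      · rw [hfloor n hge (by linarith)] at h0
        omega
    · have hnm := hne m hm.1.le (by linarith [hm.2])
      refine ⟨fun k => ⟨hsub m hm.1 (by linarith [hm.2]) k,
        hsub' (m - 1) (by push_cast; linarith [hm.1]) (by push_cast; linarith [hm.2]) k⟩, ?_⟩
      rw [hfloor (m - 1) (by push_cast; linarith [hm.1]) (by push_cast; linarith [hm.2])]
      omega
    · rintro ⟨hoff, h0⟩
      rcases lt_or_ge (φ - d) n with hlt | hge
      · rw [hfloor (n - 1) (by push_cast; linarith) (by push_cast; linarith)] at h0
        omega
      · rw [hfloor n hge (by linarith)] at h0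
        have hnm : n = m := by omega
        have := (hoff n).2
        rw [← hnm]
        exact ⟨lt_of_le_of_ne (by linarith) this.symm, hfl1⟩
    · have hnm := hne m (by linarith [hm.1]) hm.2
      refine ⟨fun k => ⟨hsub m (by linarith [hm.1]) hm.2 k,
        hsub' m (by linarith [hm.1]) (by linarith [hm.2]) k⟩, ?_⟩
      rw [hfloor m (by linarith [hm.1]) (by linarith [hm.2])]
      omega
  have hshift : ∀ τ e x y : ℝ, τ + e - c ∈ Ioo x y ↔ τ ∈ Ioo (x - e + c) (y - e + c) := by
    intro τ e x y
    simp only [mem_Ioo]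
    constructor <;> rintro ⟨h1, h2⟩ <;> constructor <;> linarith
  set θ : ℝ := J / q with hθ
  obtain ⟨m, hm | hm⟩ := Int.even_or_odd' i
  · refine ⟨m - i * θ + c, m + d - i * θ + c, m - i * θ + c, m + θ - (i + 1) * θ + c,
      by linarith, by linarith, by linarith, by linarith, fun τ u => ⟨fun h1 h2 => ?_, fun hu => ?_,
      fun hu => ?_⟩⟩
    · rw [(hstrip m τ u h1 h2).1 hm, hshift]
    · rw [(hline i m τ u hu).1 hm, hshift]
      ring_nf
    · rw [(hline (i + 1) m τ u (by rw [hu]; push_cast; ring)).2 (by omega), hshift]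
      push_cast
      ring_nf
  · refine ⟨m + d - i * θ + c, m + 1 - i * θ + c, m + θ - i * θ + c, m + 1 - (i + 1) * θ + c,
      by linarith, by linarith, by linarith, by linarith, fun τ u => ⟨fun h1 h2 => ?_, fun hu => ?_,
      fun hu => ?_⟩⟩
    · rw [(hstrip m τ u h1 h2).2 hm, hshift]
    · rw [(hline i m τ u hu).2 hm, hshift]
      ring_nf
    · rw [(hline (i + 1) (m + 1) τ u (by rw [hu]; push_cast; ring)).1 (by omega), hshift]
      push_cast
      ring_nf

end IsPinchData

/-! ### The class of the curve produced by surgery -/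

namespace IsPinchData

variable {p q : ℕ} {t J : ℤ} {c d : ℝ}

theorem isClosed_surgery (h : IsPinchData p q t J d) (hpq : p.Coprime q) :
    IsClosed (surgery (torusKnot p q) (straightBand p q c d)) := by
  have hb : Continuous (straightBand p q c d) :=
    continuous_torusPoint.comp (f := fun a : ℝ × ℝ =>
      (((c + d * a.1) * p + a.2 / q, (c + d * a.1) * q) : ℝ × ℝ)) (by fun_prop)
  have hs : Continuous fun τ : ℝ => strandPoint p q τ 0 :=
    continuous_torusPoint.comp (f := fun τ : ℝ => ((τ * p + 0 / q, τ * q) : ℝ × ℝ)) (by fun_prop)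
  have hd := h.d_pos
  have hd1 := h.d_lt
  have hd2 := h.d_lt'
  refine IsClosed.union ?_ ((((Set.toFinite _).isCompact.prod isCompact_Icc).image hb).isClosed)
  have heq : torusKnot p q \ straightBand p q c d '' (Ioo 0 1 ×ˢ {0, 1}) =
      (fun τ => strandPoint p q τ 0) ''
        (Icc c (c + 1) \ (Ioo c (c + d) ∪ Ioo (c + J / q) (c + J / q + d))) := by
    ext x
    constructor
    · rintro ⟨⟨τ, rfl⟩, hx⟩
      have hτ : torusPoint (τ * p) (τ * q) = strandPoint p q (c + Int.fract (τ - c)) 0 := by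
        have : torusPoint (τ * p) (τ * q) = strandPoint p q τ 0 := by simp [strandPoint]
        rw [this, strandPoint_eq_iff h.q_pos h.bezout]
        refine ⟨⌊τ - c⌋, 0, ?_, by simp⟩
        have := Int.floor_add_fract (τ - c)
        push_cast
        linarith
      refine ⟨_, ⟨⟨?_, ?_⟩, fun hmem => hx ?_⟩, hτ.symm⟩
      · linarith [Int.fract_nonneg (τ - c)]
      · linarith [Int.fract_lt_one (τ - c)]
      · simp only
        rw [hτ, h.mem_arcs_iff]
        refine ⟨⟨0, by simp⟩, 0, ?_⟩
        simp only [Int.floor_zero, Int.cast_zero, zero_mul, add_zero, zero_add]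
        rcases hmem with hm | hm
        · left; constructor <;> linarith [hm.1, hm.2]
        · right; constructor <;> linarith [hm.1, hm.2]
    · rintro ⟨τ, ⟨hτ, hτ'⟩, rfl⟩
      refine ⟨(strandPoint_mem_torusKnot h.q_pos hpq).2 ⟨0, by simp⟩, fun hmem => hτ' ?_⟩
      simp only [h.mem_arcs_iff, Int.floor_zero, Int.cast_zero, zero_mul, add_zero] at hmem
      obtain ⟨-, n, hn⟩ := hmem
      have h1 : (n : ℝ) < 1 := by
        rcases hn with hn | hn <;> linarith [hn.1, hτ.2]
      have h2 : (-1 : ℝ) < n := by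
        rcases hn with hn | hn <;> linarith [hn.2, hτ.1]
      have h1' : n < 1 := by exact_mod_cast h1
      have h2' : -1 < n := by exact_mod_cast h2
      have h0 : n = 0 := by omega
      subst h0
      simp only [Int.cast_zero, zero_add] at hn
      rcases hn with hn | hn
      · left; constructor <;> linarith [hn.1, hn.2]
      · right; constructor <;> linarith [hn.1, hn.2]
  rw [heq]
  exact ((isCompact_Icc.diff (isOpen_Ioo.union isOpen_Ioo)).image hs).isClosed

/-- The region with label zero is connected: it is a chain of convex pieces of the strips between
adjacent strands, and consecutive pieces share a removed arc. -/
theorem isPathConnected_region (h : IsPinchData p q t J d) (hpq : p.Coprime q) :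
    IsPathConnected {s : ℝ × ℝ | strandPoint p q s.1 s.2 ∉
      surgery (torusKnot p q) (straightBand p q c d) ∧ pinchLabel q J c d s.1 s.2 = 0} := by
  set R := {s : ℝ × ℝ | strandPoint p q s.1 s.2 ∉
      surgery (torusKnot p q) (straightBand p q c d) ∧ pinchLabel q J c d s.1 s.2 = 0} with hR
  have hd := h.d_pos
  have hcont : Continuous fun s : ℝ × ℝ => strandPoint p q s.1 s.2 :=
    continuous_torusPoint.comp (f := fun s : ℝ × ℝ => ((s.1 * p + s.2 / q, s.1 * q) : ℝ × ℝ))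
      (by fun_prop)
  have hopen : IsOpen R := by
    refine isOpen_iff_mem_nhds.2 fun s hs => ?_
    have h1 : ∀ᶠ s' in 𝓝 s, strandPoint p q s'.1 s'.2 ∉
        surgery (torusKnot p q) (straightBand p q c d) :=
      hcont.continuousAt.eventually ((h.isClosed_surgery hpq).isOpen_compl.mem_nhds hs.1)
    filter_upwards [h1, h.pinchLabel_eventually hpq hs.1] with s' h2 h3
    exact ⟨h2, h3.trans hs.2⟩
  choose lo hi a b hloa hahi hlob hbhi H using h.exists_strip hpq c
  set D : ℤ → Set (ℝ × ℝ) := fun i => R ∩ {s | (i : ℝ) ≤ s.2 ∧ s.2 ≤ i + 1} with hD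
  have hDmem : ∀ i (s : ℝ × ℝ), s ∈ D i → s.1 ∈ Ioo (lo i) (hi i) ∧
      (s.2 = i → s.1 ∈ Ioo (a i) (a i + d)) ∧ (s.2 = i + 1 → s.1 ∈ Ioo (b i) (b i + d)) := by
    rintro i s ⟨hsR, hs1, hs2⟩
    obtain ⟨H1, H2, H3⟩ := H i s.1 s.2
    refine ⟨?_, fun e => (H2 e).1 hsR, fun e => (H3 e).1 hsR⟩
    rcases hs1.eq_or_lt with e | h1
    · have := (H2 e.symm).1 hsR
      exact ⟨(hloa i).trans_lt this.1, this.2.trans_le (hahi i)⟩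
    rcases hs2.eq_or_lt with e | h2
    · have := (H3 e).1 hsR
      exact ⟨(hlob i).trans_lt this.1, this.2.trans_le (hbhi i)⟩
    exact (H1 h1 h2).1 hsR
  have hconv : ∀ i, Convex ℝ (D i) := by
    intro i
    rw [convex_iff_forall_pos]
    intro x hx y hy α β hα hβ hαβ
    obtain ⟨hx1, hx2, hx3⟩ := hDmem i x hx
    obtain ⟨hy1, hy2, hy3⟩ := hDmem i y hy
    have hx4 := hx.2
    have hy4 := hy.2
    have hconvI : ∀ u v : ℝ, x.1 ∈ Ioo u v → y.1 ∈ Ioo u v → α * x.1 + β * y.1 ∈ Ioo u v :=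
      fun u v h1 h2 => (convex_Ioo u v) h1 h2 hα.le hβ.le hαβ
    have hz4 : α * x.2 + β * y.2 ∈ Icc (i : ℝ) (i + 1) :=
      (convex_Icc (i : ℝ) (i + 1)) hx4 hy4 hα.le hβ.le hαβ
    have hβ' : β = 1 - α := by linarith
    refine ⟨?_, hz4⟩
    obtain ⟨H1, H2, H3⟩ := H i (α * x.1 + β * y.1) (α * x.2 + β * y.2)
    change strandPoint p q (α * x.1 + β * y.1) (α * x.2 + β * y.2) ∉ _ ∧
      pinchLabel q J c d (α * x.1 + β * y.1) (α * x.2 + β * y.2) = 0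
    rcases hz4.1.eq_or_lt with e | h1
    · have e1 : α * (x.2 - i) + β * (y.2 - i) = 0 := by rw [hβ'] at e ⊢; linarith
      have e2 : 0 ≤ α * (x.2 - i) := mul_nonneg hα.le (by linarith [hx4.1])
      have e3 : 0 ≤ β * (y.2 - i) := mul_nonneg hβ.le (by linarith [hy4.1])
      have e4 : x.2 - i = 0 := by
        have : α * (x.2 - i) = 0 := by linarith
        exact (mul_eq_zero.1 this).resolve_left hα.ne'
      have e5 : y.2 - i = 0 := by
        have : β * (y.2 - i) = 0 := by linarith
        exact (mul_eq_zero.1 this).resolve_left hβ.ne'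
      exact (H2 e.symm).2 (hconvI _ _ (hx2 (by linarith)) (hy2 (by linarith)))
    rcases hz4.2.eq_or_lt with e | h2
    · have e1 : α * (i + 1 - x.2) + β * (i + 1 - y.2) = 0 := by rw [hβ'] at e ⊢; linarith
      have e2 : 0 ≤ α * (i + 1 - x.2) := mul_nonneg hα.le (by linarith [hx4.2])
      have e3 : 0 ≤ β * (i + 1 - y.2) := mul_nonneg hβ.le (by linarith [hy4.2])
      have e4 : i + 1 - x.2 = 0 := by
        have : α * (i + 1 - x.2) = 0 := by linarith
        exact (mul_eq_zero.1 this).resolve_left hα.ne'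
      have e5 : i + 1 - y.2 = 0 := by
        have : β * (i + 1 - y.2) = 0 := by linarith
        exact (mul_eq_zero.1 this).resolve_left hβ.ne'
      exact (H3 e).2 (hconvI _ _ (hx3 (by linarith)) (hy3 (by linarith)))
    exact (H1 h1 h2).2 (hconvI _ _ hx1 hy1)
  have hmeet : ∀ i : ℤ, ((b i + d / 2, (i + 1 : ℝ)) : ℝ × ℝ) ∈ D i ∩ D (i + 1) := by
    intro i
    have hm : ((b i + d / 2, (i + 1 : ℝ)) : ℝ × ℝ) ∈ R :=
      ((H i (b i + d / 2) (i + 1)).2.2 rfl).2 ⟨by linarith, by linarith⟩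
    refine ⟨⟨hm, ?_, le_rfl⟩, hm, ?_, ?_⟩
    · change (i : ℝ) ≤ i + 1
      linarith
    · change ((i + 1 : ℤ) : ℝ) ≤ i + 1
      push_cast
      exact le_rfl
    · change (i : ℝ) + 1 ≤ (i + 1 : ℤ) + 1
      push_cast
      linarith
  have hunion : R = ⋃ i, D i := by
    refine subset_antisymm (fun s hs => mem_iUnion.2 ?_) (iUnion_subset fun i => inter_subset_left)
    exact ⟨⌊s.2⌋, hs, Int.floor_le _, (Int.lt_floor_add_one _).le⟩
  have hDconn : ∀ i, IsConnected (D i) := fun i => ⟨⟨_, (hmeet i).1⟩, (hconv i).isPreconnected⟩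
  have hchain : ∀ i, (D i ∩ D (Order.succ i)).Nonempty := fun i => ⟨_, hmeet i⟩
  rw [← hopen.isConnected_iff_isPathConnected, hunion]
  exact IsConnected.iUnion_of_chain hDconn hchain

/-- Surgery takes the class `(p, q)` to `(2t - p, 2J - q)`. -/
theorem isTorusCurve_surgery (h : IsPinchData p q t J d) (hpq : p.Coprime q) :
    IsTorusCurve (surgery (torusKnot p q) (straightBand p q c d)) (2 * t - p) (2 * J - q) where
  isClosed := h.isClosed_surgery hpq
  norm_eq := by
    rintro _ (⟨⟨τ, rfl⟩, -⟩ | ⟨a, -, rfl⟩)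
    · exact torusPoint_norm_eq _ _
    · exact torusPoint_norm_eq _ _
  isCoprime := ⟨-J, t, by linear_combination h.bezout⟩
  exists_label := by
    have hq' : (q : ℝ) ≠ 0 := by exact_mod_cast h.q_pos.ne'
    have hr : (J * p : ℝ) = t * q + 1 := by exact_mod_cast h.bezout
    have hco : ∀ x y : ℝ, torusPoint x y = strandPoint p q (y / q) (q * x - p * y) := by
      intro x y
      rw [strandPoint]
      congr 1 <;> field_simp
      ring
    let e : ℝ × ℝ → ℝ × ℝ := fun s => (s.2 / q, q * s.1 - p * s.2)
    let e' : ℝ × ℝ → ℝ × ℝ := fun s => (s.1 * p + s.2 / q, s.1 * q)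
    have he : Continuous e := by fun_prop
    have he' : Continuous e' := by fun_prop
    have hee' : ∀ s, e (e' s) = s := by
      rintro ⟨τ, u⟩
      refine Prod.ext ?_ ?_
      · change τ * q / q = τ
        field_simp
      · change q * (τ * p + u / q) - p * (τ * q) = u
        field_simp
        ring
    have he'e : ∀ s, e' (e s) = s := by
      rintro ⟨x, y⟩
      refine Prod.ext ?_ ?_
      · change y / q * p + (q * x - p * y) / q = x
        field_simp
        ring
      · change y / q * q = y
        field_simp
    refine ⟨fun s => pinchLabel q J c d (e s).1 (e s).2, fun s hs => ?_, fun s M N => ?_, ?_⟩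
    · rw [hco] at hs
      exact he.continuousAt.eventually (h.pinchLabel_eventually hpq (s := e s) hs)
    · have hu : (e (s.1 + M, s.2 + N)).2 = (e s).2 + ((q * M - p * N : ℤ) : ℝ) := by
        change q * (s.1 + M) - p * (s.2 + N) = q * s.1 - p * s.2 + ((q * M - p * N : ℤ) : ℝ)
        push_cast; ring
      have hτ : (e (s.1 + M, s.2 + N)).1 = (e s).1 + N / q := by
        change (s.2 + N) / q = s.2 / q + N / q
        ring
      simp only
      rw [pinchLabel, hu, hτ, Int.floor_add_intCast, pinchLabel]
      have hs : (e s).1 + N / q + ((⌊(e s).2⌋ + (q * M - p * N) : ℤ) : ℝ) * (J / q) - c =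
          (e s).1 + (⌊(e s).2⌋ : ℝ) * (J / q) - c + ((M * J - t * N : ℤ) : ℝ) := by
        push_cast
        field_simp
        linear_combination -N * hr
      rw [hs, Int.floor_add_intCast, add_sub_right_comm _ ((M * J - t * N : ℤ) : ℝ) d,
        Int.floor_add_intCast]
      ring
    · have hset : {s : ℝ × ℝ | torusPoint s.1 s.2 ∉
          surgery (torusKnot p q) (straightBand p q c d) ∧
            pinchLabel q J c d (e s).1 (e s).2 = 0} = e' '' {s : ℝ × ℝ | strandPoint p q s.1 s.2 ∉
          surgery (torusKnot p q) (straightBand p q c d) ∧ pinchLabel q J c d s.1 s.2 = 0} := by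
        ext s
        constructor
        · rintro ⟨h1, h2⟩
          rw [hco] at h1
          exact ⟨e s, ⟨h1, h2⟩, he'e s⟩
        · rintro ⟨s, ⟨h1, h2⟩, rfl⟩
          refine ⟨h1, ?_⟩
          rw [hee']
          exact h2
      rw [hset]
      exact (h.isPathConnected_region hpq).image he'

end IsPinchData

/-! ### The knots produced by pinch moves -/

/-- The classes, up to signs, of the knots that pinch moves produce from `T(4m, (2m+1)²)`: the
unknots, and the torus knots `T(2j, 2j(m+1)+1)` and their mirror images, in either order of the
coordinates. The knot `K_m` is the one with `j = 2m`. -/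
def IsPinchClass (m : ℕ) (a b : ℤ) : Prop :=
  (a.natAbs = 1 ∨ b.natAbs = 1) ∨ ∃ j : ℕ, 1 ≤ j ∧
    ((a.natAbs = 2 * j ∧ b.natAbs = 2 * j * (m + 1) + 1) ∨
      (a.natAbs = 2 * j * (m + 1) + 1 ∧ b.natAbs = 2 * j))

/-- Some homeomorphism of the three-sphere carries `K` to a curve on the torus whose class is one of
`IsPinchClass m`. -/
def HasPinchClass (m : ℕ) (K : Set S3) : Prop :=
  ∃ (L : Set S3) (a b : ℤ) (h : S3 ≃ₜ S3), h '' K = L ∧ IsTorusCurve L a b ∧ IsPinchClass m a b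

theorem Isotopic.exists_homeomorph {K L : Set S3} (h : Isotopic K L) :
    ∃ e : S3 ≃ₜ S3, e '' K = L := by
  obtain ⟨H, -, -, h⟩ := h
  exact ⟨H 1, h⟩

theorem image_symm_eq {K L : Set S3} {e : S3 ≃ₜ S3} (h : e '' K = L) : e.symm '' L = K := by
  rw [← h, ← image_comp, Homeomorph.symm_comp_self, image_id]

theorem HasPinchClass.of_image {m : ℕ} {K L : Set S3} (hK : HasPinchClass m K) {e : S3 ≃ₜ S3}
    (h : e '' K = L) : HasPinchClass m L := by
  obtain ⟨K', a, b, f, hf, hK', hab⟩ := hK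
  refine ⟨K', a, b, e.symm.trans f, ?_, hK', hab⟩
  change (f ∘ e.symm) '' L = K'
  rw [image_comp, image_symm_eq h, hf]

theorem HasPinchClass.isPinchClass {m : ℕ} {K : Set S3} (hK : HasPinchClass m K) {p q : ℤ}
    (h : IsTorusCurve K p q) : IsPinchClass m p q := by
  obtain ⟨K', a, b, f, hf, hK', hab⟩ := hK
  rcases h.natAbs_eq hK' f hf with ⟨-, h1⟩ | ⟨h1, h2⟩ | ⟨h1, h2⟩
  · exact Or.inl h1
  · rw [IsPinchClass, h1, h2]
    exact hab
  · rw [IsPinchClass, h1, h2]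
    rcases hab with hab | ⟨j, hj, hab⟩
    · exact Or.inl hab.symm
    · exact Or.inr ⟨j, hj, hab.symm.imp And.symm And.symm⟩

theorem bezout_unique {p q J t J' t' : ℤ} (hJ : J * p = t * q + 1) (hJ0 : 0 ≤ J) (hJq : J < q)
    (hJ' : J' * p = t' * q + 1) (hJ0' : 0 ≤ J') (hJq' : J' < q) : J = J' ∧ t = t' := by
  have hdvd : q ∣ J - J' := ⟨t * J' - J * t', by linear_combination J' * hJ - J * hJ'⟩
  have h0 : J - J' = 0 := Int.eq_zero_of_abs_lt_dvd hdvd (abs_lt.2 ⟨by linarith, by linarith⟩)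
  have hJJ : J = J' := by linarith
  refine ⟨hJJ, ?_⟩
  have hq : q ≠ 0 := by linarith
  subst hJJ
  exact mul_right_cancel₀ hq (by linarith)

/-- The arithmetic of a pinch move: it takes `T(2j, 2j(m+1)+1)` to `T(2(j-1), 2(j-1)(m+1)+1)`. -/
theorem IsPinchClass.pinch {m p q : ℕ} (h : IsPinchClass m p q) {J t : ℤ}
    (hJ : J * p = t * q + 1) (hJ0 : 0 < J) (hJq : J < q) :
    IsPinchClass m (2 * t - p) (2 * J - q) := by
  rw [IsPinchClass, Int.natAbs_natCast, Int.natAbs_natCast] at h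
  rcases h with (rfl | rfl) | ⟨j, hj, ⟨rfl, rfl⟩ | ⟨rfl, rfl⟩⟩
  · have ht := (bezout_unique (J' := 1) (t' := 0) hJ hJ0.le hJq (by simp) (by norm_num)
      (by linarith)).2
    left; left
    rw [ht]
    rfl
  · push_cast at hJq
    omega
  all_goals obtain ⟨k, rfl⟩ := Nat.exists_eq_add_of_le' hj
  · have hm : (0 : ℤ) ≤ m := by positivity
    have hk : (0 : ℤ) ≤ k := by positivity
    obtain ⟨rfl, rfl⟩ := bezout_unique (J' := (2 * k + 1) * (m + 1) + 1) (t' := 2 * k + 1)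
      hJ hJ0.le hJq (by push_cast; ring) (by positivity) (by push_cast; nlinarith)
    have h1 : (2 * (2 * k + 1) - (2 * (k + 1) : ℕ) : ℤ) = (2 * k : ℕ) := by push_cast; ring
    have h2 : (2 * ((2 * k + 1) * (m + 1) + 1) - (2 * (k + 1) * (m + 1) + 1 : ℕ) : ℤ) =
        (2 * k * (m + 1) + 1 : ℕ) := by push_cast; ring
    rw [IsPinchClass, h1, h2, Int.natAbs_natCast, Int.natAbs_natCast]
    rcases Nat.eq_zero_or_pos k with rfl | hk
    · left; right; simp
    · exact Or.inr ⟨k, hk, Or.inl ⟨rfl, rfl⟩⟩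
  · obtain ⟨rfl, rfl⟩ := bezout_unique (J' := 1) (t' := m + 1)
      hJ hJ0.le hJq (by push_cast; ring) (by norm_num) (by push_cast; linarith)
    have h1 : (2 * (m + 1) - (2 * (k + 1) * (m + 1) + 1 : ℕ) : ℤ) =
        -(2 * k * (m + 1) + 1 : ℕ) := by push_cast; ring
    have h2 : (2 * 1 - (2 * (k + 1) : ℕ) : ℤ) = -(2 * k : ℕ) := by push_cast; ring
    rw [IsPinchClass, h1, h2, Int.natAbs_neg, Int.natAbs_neg, Int.natAbs_natCast,
      Int.natAbs_natCast]
    rcases Nat.eq_zero_or_pos k with rfl | hk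
    · left; left; simp
    · exact Or.inr ⟨k, hk, Or.inr ⟨rfl, rfl⟩⟩

theorem HasPinchClass.of_pinchMove {m : ℕ} {K L : Set S3} (hK : HasPinchClass m K)
    (h : PinchMove K L) : HasPinchClass m L := by
  obtain ⟨p, q, c, d, hp, hq, hpq, hd, hKT, hb, hSL⟩ := h
  obtain ⟨e, he⟩ := hKT.exists_homeomorph
  have hT := (hK.of_image he).isPinchClass (isTorusCurve_torusKnot hpq)
  have hq' : (0 : ℤ) < q := by exact_mod_cast hq
  obtain ⟨u, v, huv⟩ := Nat.isCoprime_iff_coprime.2 hpq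
  have hJ : u % q * p = (-(v + u / q * p)) * q + 1 := by
    linear_combination huv + p * Int.emod_add_mul_ediv u q
  have hJ0 := Int.emod_nonneg u hq'.ne'
  have hJq := Int.emod_lt_of_pos u hq'
  have hdata := IsPinchData.of_isBand hq hJ hJ0 hJq hd hb
  -- The band has positive length, which excludes a time shift of zero and so the case `q = 1`.
  have hJ1 : 0 < u % q := by
    have h1 := hdata.d_pos.trans hdata.d_lt
    have h2 : (0 : ℝ) < (u % q : ℤ) := by
      by_contra hcon
      exact h1.not_ge (div_nonpos_of_nonpos_of_nonneg (not_lt.1 hcon) (by positivity))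
    exact_mod_cast h2
  obtain ⟨f, hf⟩ := hSL.exists_homeomorph
  exact HasPinchClass.of_image ⟨_, _, _, Homeomorph.refl S3, image_id _,
    hdata.isTorusCurve_surgery hpq, hT.pinch hJ hJ1 hJq⟩ hf

theorem isTorusCurve_knotK (n : ℕ) :
    IsTorusCurve (knotK n) (4 * n : ℕ) ((2 * n + 1) ^ 2 : ℕ) := by
  refine isTorusCurve_torusKnot ?_
  rw [← Nat.isCoprime_iff_coprime]
  exact ⟨-(n + 1), 1, by push_cast; ring⟩

theorem hasPinchClass_knotK (m : ℕ) : HasPinchClass m (knotK m) := by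
  refine ⟨_, _, _, Homeomorph.refl S3, image_id _, isTorusCurve_knotK m, ?_⟩
  rw [IsPinchClass, Int.natAbs_natCast, Int.natAbs_natCast]
  rcases Nat.eq_zero_or_pos m with rfl | hm
  · left; right; simp
  · exact Or.inr ⟨2 * m, by omega, Or.inl ⟨by ring, by ring⟩⟩

theorem eq_of_hasPinchClass_knotK {m n : ℕ} (hn : 1 ≤ n) (h : HasPinchClass m (knotK n)) :
    m = n := by
  have h' := h.isPinchClass (isTorusCurve_knotK n)
  rw [IsPinchClass, Int.natAbs_natCast, Int.natAbs_natCast] at h'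
  have hsq : (2 * n + 1) ^ 2 = 2 * (2 * n * (n + 1)) + 1 := by ring
  rcases h' with (h1 | h1) | ⟨j, -, ⟨h1, h2⟩ | ⟨h1, h2⟩⟩
  · omega
  · have : 0 < n * (n + 1) := by positivity
    nlinarith
  · have hj : j = 2 * n := by omega
    subst hj
    have h3 : 4 * n * (m + 1) = 4 * n * (n + 1) := by linarith
    have := Nat.eq_of_mul_eq_mul_left (by omega) h3
    omega
  · omega

end Pinch

theorem corollary3p5 (n m : ℕ) (hn : 1 ≤ n) (hmn : m ≠ n) :
    ¬ Pinch.ObtainedByPinchMoves (Pinch.knotK m) (Pinch.knotK n) := by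
  rintro ⟨K, hK, hKn⟩
  have hclass : Pinch.HasPinchClass m K := by
    clear hKn
    induction hK with
    | refl => exact Pinch.hasPinchClass_knotK m
    | tail _ hstep ih => exact ih.of_pinchMove hstep
  obtain ⟨e, he⟩ := hKn.exists_homeomorph
  exact hmn (Pinch.eq_of_hasPinchClass_knotK hn (hclass.of_image he))
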